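/- Notation. For $m\ge 0$ let $\mathbb{C}\langle X_1,\dots,X_m\rangle$ be the non-commutative polynomials. The scalar-valued trace polynomials $\mathrm{TrP}_m^0$ are the symmetric algebra of $\mathbb{C}\langle X_1,\dots,X_m\rangle/\mathrm{span}\{pq-qp\}$, spanned by the products $\tau(p_1)\cdots\tau(p_n)$; they are evaluated at $x\in M_N(\mathbb{C})_{sa}^m$ ($N\ge1$) by reading $\tau$ as $\tau_N=\frac1N\mathrm{Tr}$. Let $Df=(D_1f,\dots,D_mf)$, where $D_j:\mathrm{TrP}_m^0\to\mathrm{TrP}_m^0\otimes\mathbb{C}\langle X_1,\dots,X_m\rangle$ is the derivation with $D_j\tau(X_{i_1}\cdots X_{i_n})=\sum_{k:\,i_k=j}X_{i_{k+1}}\cdots X_{i_n}X_{i_1}\cdots X_{i_{k-1}}$. Write $\|y\|_2^2=\sum_j\tau_N(y_j^*y_j)$ and $\|x\|_\infty=\max_j\|x_j\|$ (operator norm). For $r>0$ put $\|f\|_r=\sup_{N\ge1}\sup_{x\in M_N(\mathbb{C})_{sa}^m,\ \|x\|_\infty\le r}|f(x)|$ and $\|Df\|_r=\sup_{N\ge1}\sup_{x\in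 M_N(\mathbb{C})_{sa}^m,\ \|x\|_\infty\le r}\|Df(x)\|_2$. Let $\mathcal{T}_m^{0,1}$ be the completion of $\mathrm{TrP}_m^0$ in the metric $$d(f,g)=\sum_{n\ge1}2^{-n}\bigl[\min(1,\|f-g\|_n)+\min(1,\|Df-Dg\|_n)\bigr].$$ By continuity every $V\in\mathcal{T}_m^{0,1}$ defines functions $V|_{M_N(\mathbb{C})_{sa}^m}$ and $DV|_{M_N(\mathbb{C})_{sa}^m}$. For a sequence of differentiable functions $\varphi_N:M_N(\mathbb{C})_{sa}^m\to\mathbb{C}$ let $D\varphi_N=N\nabla\varphi_N$ be the normalized gradient, that is, the gradient with respect to $\langle y,h\rangle_2=\sum_j\tau_N(y_jh_j)$. We say that $[\varphi_\bullet]$ is the element $V$ of $\mathcal{T}_m^{0,1}$ if for every $r$ the quantities $\limsup_{N}\sup_{\|x\|_\infty\le r}|\varphi_N(x)|$ and $\limsup_N\sup_{\|x\|_\infty\le r}\|D\varphi_N(x)\|_2$ are finite and $$\limsup_{N\to\infty}\sup_{\|x\|_\infty\le r}|\varphi_N(x)-V(x)|=0,\qquad \limsup_{N\to\infty}\sup_{\|x\|_\infty\le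 r}\|D\varphi_N(x)-DV(x)\|_2=0 .$$ For real $c,C$ let $\mathcal{E}_m(c,C)^{0,1}$ be the set of those $V\in\mathcal{T}_m^{0,1}$ such that for every $N\ge1$ the function $V|_{M_N(\mathbb{C})_{sa}^m}$ is real-valued, $V(x)-\frac c2\|x\|_2^2$ is convex and $V(x)-\frac C2\|x\|_2^2$ is concave on $M_N(\mathbb{C})_{sa}^m$. **Proposition.** Let $f\in\mathrm{TrP}_m^0$, let $R>0$, and let $\phi:\mathbb{R}\to\mathbb{R}$ be a $C^\infty$ function with $\phi(t)=t$ for $|t|\le R$ and $\phi(t)=0$ for $|t|\ge 2R$. Put $\Phi_N(x)=(\phi(x_1),\dots,\phi(x_m))$ (functional calculus), and for $\epsilon\in\mathbb{R}$ $$\tilde V_N^{(\epsilon)}(x)=\tfrac12\|x\|_2^2+\epsilon f(\Phi_N(x)),\qquad x\in M_N(\mathbb{C})_{sa}^m .$$ Then for every $\epsilon\in\mathbb{R}$ the class $[\tilde V_\bullet^{(\epsilon)}]$ is an element of $\mathcal{T}_m^{0,1}$. Moreover, if $f$ is real-valued on $M_N(\mathbb{C})_{sa}^m$ for every $N\ge1$,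 then for every $\delta>0$ there is $\epsilon_0>0$ (depending on $f$, $R$, $\phi$ and $\delta$) such that $[\tilde V_\bullet^{(\epsilon)}]\in\mathcal{E}_m(1-\delta,1+\delta)^{0,1}$ for all real $\epsilon$ with $|\epsilon|<\epsilon_0$. -/

import Mathlib

open scoped Matrix.Norms.L2Operator TensorProduct ENNReal ContDiff

noncomputable section

namespace TracePoly

/-! ### Non-commutative polynomials and trace polynomials -/

/-- Non-commutative polynomials `ℂ⟨X₁, …, X_m⟩`. -/
abbrev NCP (m : ℕ) : Type := FreeAlgebra ℂ (Fin m)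

/-- The monomial `X_{i₁} ⋯ X_{i_n}`. -/
def word {m : ℕ} (w : List (Fin m)) : NCP m := (w.map (FreeAlgebra.ι ℂ)).prod

theorem basis_eq_word {m : ℕ} (w : FreeMonoid (Fin m)) :
    FreeAlgebra.basisFreeMonoid ℂ (Fin m) w = word w.toList := by
  change (FreeAlgebra.equivMonoidAlgebraFreeMonoid.symm) (MonoidAlgebra.single w 1) = _
  rw [AlgEquiv.symm_apply_eq]
  induction w using FreeMonoid.recOn with
  | one => simp [word, MonoidAlgebra.one_def]
  | of_mul x xs ih =>
    simp only [word, FreeMonoid.toList_mul, List.map_append, List.prod_append, map_mul,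
      FreeMonoid.toList_of, List.map_cons, List.map_nil, List.prod_cons, List.prod_nil] at ih ⊢
    rw [← ih]
    simp [FreeAlgebra.equivMonoidAlgebraFreeMonoid, MonoidAlgebra.single_mul_single]

/-- The subspace of `ℂ⟨X₁, …, X_m⟩` spanned by the commutators `p q - q p`. -/
def commutators (m : ℕ) : Submodule ℂ (NCP m) :=
  Submodule.span ℂ (Set.range fun pq : NCP m × NCP m => pq.1 * pq.2 - pq.2 * pq.1)

/-- `ℂ⟨X₁, …, X_m⟩` modulo the span of the commutators. -/
abbrev CyclicNCP (m : ℕ) : Type := NCP m ⧸ commutators m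

/-- Scalar-valued trace polynomials: the symmetric algebra (the direct sum of all symmetric
tensor powers) over `CyclicNCP m`. -/
abbrev TrP0 (m : ℕ) : Type := SymmetricAlgebra ℂ (CyclicNCP m)

/-- Operator-valued trace polynomials `TrP⁰ ⊗ ℂ⟨X₁, …, X_m⟩`. -/
abbrev TrP1 (m : ℕ) : Type := TrP0 m ⊗[ℂ] NCP m

/-- The formal trace `p ↦ τ(p)`. -/
def tr {m : ℕ} : NCP m →ₗ[ℂ] TrP0 m :=
  SymmetricAlgebra.ι ℂ (CyclicNCP m) ∘ₗ (commutators m).mkQ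

/-- A linear map with `g (p q) = g (q p)` descends to `CyclicNCP m`. -/
def descend {m : ℕ} {E : Type*} [AddCommGroup E] [Module ℂ E] (g : NCP m →ₗ[ℂ] E)
    (hg : ∀ p q, g (p * q) = g (q * p)) : CyclicNCP m →ₗ[ℂ] E :=
  (commutators m).liftQ g (by
    rw [commutators, Submodule.span_le]
    rintro _ ⟨pq, rfl⟩
    simp [hg pq.1 pq.2])

/-! ### The gradient of a trace polynomial -/

/-- The cyclic derivative of a monomial:
`X_{i₁} ⋯ X_{i_n} ↦ ∑_{k : i_k = j} X_{i_{k+1}} ⋯ X_{i_n} X_{i₁} ⋯ X_{i_{k-1}}`. -/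
def cyclicDerivWord {m : ℕ} (j : Fin m) (w : List (Fin m)) : NCP m :=
  ∑ k : Fin w.length, if w.get k = j then word (w.drop (k + 1) ++ w.take k) else 0

/-- The cyclic derivative `𝒟_j° : ℂ⟨X₁, …, X_m⟩ → ℂ⟨X₁, …, X_m⟩`. -/
def cyclicDeriv {m : ℕ} (j : Fin m) : NCP m →ₗ[ℂ] NCP m :=
  (FreeAlgebra.basisFreeMonoid ℂ (Fin m)).constr ℂ fun w => cyclicDerivWord j w.toList

theorem cyclicDeriv_word {m : ℕ} (j : Fin m) (w : List (Fin m)) :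
    cyclicDeriv j (word w) = cyclicDerivWord j w := by
  have h := (FreeAlgebra.basisFreeMonoid ℂ (Fin m)).constr_basis ℂ
    (fun w => cyclicDerivWord j w.toList) (FreeMonoid.ofList w)
  rw [basis_eq_word] at h
  exact h

theorem cyclicDerivWord_append {m : ℕ} (j : Fin m) (u v : List (Fin m)) :
    cyclicDerivWord j (u ++ v) = cyclicDerivWord j (v ++ u) := by
  have key : ∀ u v : List (Fin m), cyclicDerivWord j (u ++ v) =
      (∑ k : Fin u.length, if u.get k = j then word (u.drop (k + 1) ++ v ++ u.take k) else 0) +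
      ∑ k : Fin v.length, if v.get k = j then word (v.drop (k + 1) ++ u ++ v.take k) else 0 := by
    intro u v
    have e : (u ++ v).length = u.length + v.length := List.length_append
    unfold cyclicDerivWord
    rw [← (finCongr e).symm.sum_comp, Fin.sum_univ_add]
    congr 1
    · refine Finset.sum_congr rfl fun k _ => ?_
      have hk := k.2
      simp [List.getElem_append_left hk, List.drop_append_of_le_length hk,
        List.take_append_of_le_length hk.le]
    · refine Finset.sum_congr rfl fun k _ => ?_
      have h1 : u.length + (k : ℕ) + 1 = u.length + ((k : ℕ) + 1) := by omega
      have h2 : u.drop (u.length + ((k : ℕ) + 1)) = [] := List.drop_eq_nil_of_le (by omega)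
      have h3 : u.take (u.length + (k : ℕ)) = u := List.take_of_length_le (by omega)
      simp [h1, h2, h3, List.drop_append, List.take_append]
  rw [key, key, add_comm]

theorem cyclicDeriv_comm {m : ℕ} (j : Fin m) (p q : NCP m) :
    cyclicDeriv j (p * q) = cyclicDeriv j (q * p) := by
  have h : (LinearMap.mul ℂ (NCP m)).compr₂ (cyclicDeriv j) =
      (LinearMap.mul ℂ (NCP m)).flip.compr₂ (cyclicDeriv j) := by
    refine (FreeAlgebra.basisFreeMonoid ℂ (Fin m)).ext fun u =>
      (FreeAlgebra.basisFreeMonoid ℂ (Fin m)).ext fun v => ?_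
    have hw : ∀ a b : List (Fin m), word a * word b = word (a ++ b) := by
      intro a b; simp [word]
    simp [basis_eq_word, hw, cyclicDeriv_word, cyclicDerivWord_append j u.toList]
  exact LinearMap.congr_fun (LinearMap.congr_fun h p) q

/-- The map `f ↦ (f, D_j f)` into the square-zero extension of `TrP⁰` by the `TrP⁰`-module
`TrP¹`; it is the algebra homomorphism with `τ(p) ↦ (τ(p), 𝒟_j° p)`. -/
def gradAux {m : ℕ} (j : Fin m) : TrP0 m →ₐ[ℂ] TrivSqZeroExt (TrP0 m) (TrP1 m) :=
  SymmetricAlgebra.lift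
    ((TrivSqZeroExt.inlAlgHom ℂ (TrP0 m) (TrP1 m)).toLinearMap ∘ₗ
        SymmetricAlgebra.ι ℂ (CyclicNCP m) +
      ((TrivSqZeroExt.inrHom (TrP0 m) (TrP1 m)).restrictScalars ℂ) ∘ₗ
        (TensorProduct.mk ℂ (TrP0 m) (NCP m) 1) ∘ₗ descend (cyclicDeriv j) (cyclicDeriv_comm j))

/-- The `j`-th gradient operator `D_j : TrP⁰ → TrP¹`, the derivation with
`D_j τ(p) = 𝒟_j° p`. -/
def grad {m : ℕ} (j : Fin m) : TrP0 m →ₗ[ℂ] TrP1 m :=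
  ((TrivSqZeroExt.sndHom (TrP0 m) (TrP1 m)).restrictScalars ℂ) ∘ₗ (gradAux j).toLinearMap

theorem grad_tr {m : ℕ} (j : Fin m) (p : NCP m) : grad j (tr p) = 1 ⊗ₜ[ℂ] cyclicDeriv j p := by
  simp [grad, gradAux, tr, descend, TensorProduct.mk_apply]

theorem grad_mul {m : ℕ} (j : Fin m) (f g : TrP0 m) :
    grad j (f * g) = f • grad j g + g • grad j f := by
  have h : ∀ f : TrP0 m, (gradAux j f).fst = f := by
    intro f
    have : (TrivSqZeroExt.fstHom ℂ (TrP0 m) (TrP1 m)).comp (gradAux j) = AlgHom.id ℂ (TrP0 m) := by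
      refine SymmetricAlgebra.algHom_ext ?_
      ext p
      simp [gradAux]
    exact DFunLike.congr_fun this f
  simp [grad, h]

/-! ### Evaluation on tuples of self-adjoint matrices -/

/-- `N × N` complex matrices; the norm on this type is the operator norm. -/
abbrev Mat (N : ℕ) : Type := Matrix (Fin N) (Fin N) ℂ

/-- `M_N(ℂ)_{sa}^m`; the norm `‖x‖` on this type is `‖x‖_∞ = max_j ‖x_j‖` with the operator norm
of matrices. -/
abbrev Tup (m N : ℕ) : Type := Fin m → selfAdjoint (Mat N)

/-- The normalized trace `τ_N = N⁻¹ Tr`. -/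
def ntr (N : ℕ) : Mat N →ₗ[ℂ] ℂ := (N : ℂ)⁻¹ • Matrix.traceLinearMap (Fin N) ℂ ℂ

/-- The evaluation `p ↦ p(x)` of non-commutative polynomials. -/
def evalNCP {m N : ℕ} (x : Tup m N) : NCP m →ₐ[ℂ] Mat N :=
  FreeAlgebra.lift ℂ fun j => (x j : Mat N)

/-- The evaluation of scalar-valued trace polynomials; it sends `τ(p)` to `τ_N(p(x))`. -/
def eval0 {m N : ℕ} (x : Tup m N) : TrP0 m →ₐ[ℂ] ℂ :=
  SymmetricAlgebra.lift (descend (ntr N ∘ₗ (evalNCP x).toLinearMap) (fun p q => by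
    simp [ntr, Matrix.trace_mul_comm (evalNCP x p)]))

/-- The evaluation of operator-valued trace polynomials; it sends `f ⊗ p` to `f(x) p(x)`. -/
def eval1 {m N : ℕ} (x : Tup m N) : TrP1 m →ₗ[ℂ] Mat N :=
  TensorProduct.lift
    ((LinearMap.lsmul ℂ (Mat N)).compl₁₂ (eval0 x).toLinearMap (evalNCP x).toLinearMap)

/-- The tuple `Df(x) = (D_1 f(x), …, D_m f(x))`. -/
def evalGrad {m N : ℕ} (x : Tup m N) : TrP0 m →ₗ[ℂ] (Fin m → Mat N) :=
  LinearMap.pi fun j => eval1 x ∘ₗ grad j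

/-- The normalized `2`-norm `‖y‖_2 = (∑_j τ_N(y_j^* y_j))^{1/2}` of a tuple of matrices. -/
def norm2 {m N : ℕ} (y : Fin m → Mat N) : ℝ :=
  Real.sqrt (∑ j, (ntr N ((y j).conjTranspose * y j)).re)

theorem norm2_eq {m N : ℕ} (y : Fin m → Mat N) :
    norm2 y = Real.sqrt (N : ℝ)⁻¹ *
      ‖WithLp.toLp 2 (fun i : Fin m × Fin N × Fin N => y i.1 i.2.1 i.2.2)‖ := by
  rw [EuclideanSpace.norm_eq, norm2, ← Real.sqrt_mul (by positivity), Fintype.sum_prod_type,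
    Finset.mul_sum]
  congr 1
  refine Finset.sum_congr rfl fun j _ => ?_
  have h : (ntr N ((y j).conjTranspose * y j)) =
      (((N : ℝ)⁻¹ * ∑ a, ∑ b, ‖y j b a‖ ^ 2 : ℝ) : ℂ) := by
    simp [ntr, Matrix.trace, Matrix.mul_apply, Complex.conj_mul']
  rw [h, Complex.ofReal_re, Fintype.sum_prod_type, Finset.sum_comm]

theorem norm2_add_le {m N : ℕ} (y z : Fin m → Mat N) : norm2 (y + z) ≤ norm2 y + norm2 z := by
  simp only [norm2_eq]
  rw [← mul_add]
  refine mul_le_mul_of_nonneg_left ?_ (Real.sqrt_nonneg _)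
  exact norm_add_le (WithLp.toLp 2 fun i : Fin m × Fin N × Fin N => y i.1 i.2.1 i.2.2)
    (WithLp.toLp 2 fun i : Fin m × Fin N × Fin N => z i.1 i.2.1 i.2.2)

theorem norm2_neg {m N : ℕ} (y : Fin m → Mat N) : norm2 (-y) = norm2 y := by
  simp [norm2]

theorem norm2_zero {m N : ℕ} : norm2 (0 : Fin m → Mat N) = 0 := by
  simp [norm2]

/-! ### The completion `T_m^{0,1}` of the trace polynomials together with their gradients -/

/-- `‖f‖_R = sup_N sup_{‖x‖_∞ ≤ R} |f(x)|`. -/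
def seminorm0 {m : ℕ} (R : ℝ) (f : TrP0 m) : ℝ≥0∞ :=
  ⨆ (N : ℕ) (_ : 0 < N) (x : Tup m N) (_ : ‖x‖ ≤ R), ‖eval0 x f‖ₑ

/-- `‖Df‖_R = sup_N sup_{‖x‖_∞ ≤ R} ‖Df(x)‖_2`. -/
def seminorm1 {m : ℕ} (R : ℝ) (f : TrP0 m) : ℝ≥0∞ :=
  ⨆ (N : ℕ) (_ : 0 < N) (x : Tup m N) (_ : ‖x‖ ≤ R), ENNReal.ofReal (norm2 (evalGrad x f))

/-- `∑_{n ≥ 1} 2^{-n} (min(1, ‖f‖_n) + min(1, ‖Df‖_n))`; the distance of `f` and `g` is the value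
at `f - g`. -/
def size {m : ℕ} (f : TrP0 m) : ℝ≥0∞ :=
  ∑' n : ℕ, (2⁻¹ : ℝ≥0∞) ^ (n + 1) *
    (min 1 (seminorm0 ((n : ℝ) + 1) f) + min 1 (seminorm1 ((n : ℝ) + 1) f))

theorem seminorm0_add_le {m : ℕ} (R : ℝ) (f g : TrP0 m) :
    seminorm0 R (f + g) ≤ seminorm0 R f + seminorm0 R g := by
  refine iSup₂_le fun N hN => iSup₂_le fun x hx => ?_
  rw [map_add]
  exact (enorm_add_le _ _).trans (add_le_add
    (le_iSup₂_of_le N hN (le_iSup₂_of_le x hx le_rfl))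
    (le_iSup₂_of_le N hN (le_iSup₂_of_le x hx le_rfl)))

theorem seminorm1_add_le {m : ℕ} (R : ℝ) (f g : TrP0 m) :
    seminorm1 R (f + g) ≤ seminorm1 R f + seminorm1 R g := by
  refine iSup₂_le fun N hN => iSup₂_le fun x hx => ?_
  rw [map_add]
  refine ((ENNReal.ofReal_le_ofReal (norm2_add_le _ _)).trans ENNReal.ofReal_add_le).trans
    (add_le_add
    (le_iSup₂_of_le N hN (le_iSup₂_of_le x hx le_rfl))
    (le_iSup₂_of_le N hN (le_iSup₂_of_le x hx le_rfl)))

theorem min_one_add_le (a b : ℝ≥0∞) : min 1 (a + b) ≤ min 1 a + min 1 b := by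
  rcases le_total 1 a with h | h
  · simp [min_eq_left h]
  rcases le_total 1 b with h' | h'
  · simp [min_eq_left h']
  · simp [min_eq_right h, min_eq_right h']

theorem size_add_le {m : ℕ} (f g : TrP0 m) : size (f + g) ≤ size f + size g := by
  unfold size
  rw [← ENNReal.tsum_add]
  refine ENNReal.tsum_le_tsum fun n => ?_
  rw [← mul_add]
  refine mul_le_mul' le_rfl ?_
  exact (add_le_add ((min_le_min_left 1 (seminorm0_add_le _ f g)).trans (min_one_add_le _ _))
    ((min_le_min_left 1 (seminorm1_add_le _ f g)).trans (min_one_add_le _ _))).trans_eq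
    (add_add_add_comm _ _ _ _)

theorem size_neg {m : ℕ} (f : TrP0 m) : size (-f) = size f := by
  simp [size, seminorm0, seminorm1, norm2_neg]

theorem size_zero {m : ℕ} : size (0 : TrP0 m) = 0 := by
  simp [size, seminorm0, seminorm1, norm2_zero]

/-- The (pseudo-)metric
`d(f, g) = ∑_{n ≥ 1} 2^{-n} (min(1, ‖f - g‖_n) + min(1, ‖Df - Dg‖_n))` on trace polynomials. -/
instance instPseudoEMetricSpaceTrP0 (m : ℕ) : PseudoEMetricSpace (TrP0 m) where
  edist f g := size (f - g)
  edist_self f := by rw [sub_self, size_zero]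
  edist_comm f g := by rw [← size_neg, neg_sub]
  edist_triangle f g h := by
    have := size_add_le (f - g) (g - h)
    rwa [sub_add_sub_cancel] at this

theorem edist_eq_size {m : ℕ} (f g : TrP0 m) : edist f g = size (f - g) := rfl

theorem exists_size_bound {m N : ℕ} (hN : 0 < N) (x : Tup m N) :
    ∃ c : ℝ≥0∞, c ≠ 0 ∧ ∀ f : TrP0 m, c * min 1 ‖eval0 x f‖ₑ ≤ size f ∧
      c * min 1 (ENNReal.ofReal (norm2 (evalGrad x f))) ≤ size f := by
  obtain ⟨n, hn⟩ := exists_nat_ge ‖x‖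
  have hx : ‖x‖ ≤ (n : ℝ) + 1 := hn.trans (by linarith)
  refine ⟨(2⁻¹ : ℝ≥0∞) ^ (n + 1), pow_ne_zero _ (by simp), fun f => ⟨?_, ?_⟩⟩
  · refine le_trans ?_ (ENNReal.le_tsum n)
    gcongr
    refine le_trans (min_le_min_left 1 ?_) le_self_add
    exact le_iSup₂_of_le N hN (le_iSup₂_of_le x hx le_rfl)
  · refine le_trans ?_ (ENNReal.le_tsum n)
    gcongr
    refine le_trans (min_le_min_left 1 ?_) le_add_self
    exact le_iSup₂_of_le N hN (le_iSup₂_of_le x hx le_rfl)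

theorem lt_of_mul_min_lt {c e a : ℝ≥0∞} (h : c * min 1 a < c * min 1 e) : a < e := by
  by_contra! hle
  exact absurd h (not_lt.2 (by gcongr))

theorem mul_min_pos {c e : ℝ≥0∞} (hc : c ≠ 0) (he : 0 < e) : 0 < c * min 1 e :=
  ENNReal.mul_pos hc (lt_min one_pos he).ne'

theorem uniformContinuous_eval0 {m N : ℕ} (hN : 0 < N) (x : Tup m N) :
    UniformContinuous fun f : TrP0 m => eval0 x f := by
  obtain ⟨c, hc, hb⟩ := exists_size_bound hN x
  refine EMetric.uniformContinuous_iff.2 fun e he => ⟨c * min 1 e, mul_min_pos hc he, ?_⟩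
  intro f g hfg
  rw [edist_eq_size] at hfg
  rw [edist_eq_enorm_sub, ← map_sub]
  exact lt_of_mul_min_lt (((hb (f - g)).1).trans_lt hfg)

theorem exists_norm_le_norm2 (m : ℕ) {N : ℕ} (hN : 0 < N) :
    ∃ C : ℝ, 0 < C ∧ ∀ y : Fin m → Mat N, ‖y‖ ≤ C * norm2 y := by
  let l : EuclideanSpace ℂ (Fin m × Fin N × Fin N) →ₗ[ℂ] (Fin m → Mat N) :=
    { toFun := fun v j => Matrix.of fun a b => v (j, a, b)
      map_add' := fun v w => rfl
      map_smul' := fun c v => rfl }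
  have hN' : (0 : ℝ) < Real.sqrt (N : ℝ)⁻¹ := Real.sqrt_pos.2 (by positivity)
  refine ⟨(‖l.toContinuousLinearMap‖ + 1) / Real.sqrt (N : ℝ)⁻¹, by positivity, fun y => ?_⟩
  rw [norm2_eq, div_mul_eq_mul_div, le_div_iff₀ hN', mul_comm, mul_left_comm]
  refine mul_le_mul_of_nonneg_left ?_ hN'.le
  have h := l.toContinuousLinearMap.le_opNorm
    (WithLp.toLp 2 fun i : Fin m × Fin N × Fin N => y i.1 i.2.1 i.2.2)
  have h' : l.toContinuousLinearMap
    (WithLp.toLp 2 fun i : Fin m × Fin N × Fin N => y i.1 i.2.1 i.2.2) = y := rfl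
  rw [h'] at h
  exact h.trans (by gcongr; linarith)

theorem uniformContinuous_evalGrad {m N : ℕ} (hN : 0 < N) (x : Tup m N) :
    UniformContinuous fun f : TrP0 m => evalGrad x f := by
  obtain ⟨c, hc, hb⟩ := exists_size_bound hN x
  obtain ⟨C, hC, hC'⟩ := exists_norm_le_norm2 m hN
  refine EMetric.uniformContinuous_iff.2 fun e he => ?_
  have hCe : 0 < e / ENNReal.ofReal C := ENNReal.div_pos he.ne' ENNReal.ofReal_ne_top
  refine ⟨c * min 1 (e / ENNReal.ofReal C), mul_min_pos hc hCe, ?_⟩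
  intro f g hfg
  rw [edist_eq_size] at hfg
  rw [edist_eq_enorm_sub, ← map_sub]
  have h := lt_of_mul_min_lt (((hb (f - g)).2).trans_lt hfg)
  rw [ENNReal.lt_div_iff_mul_lt (Or.inl (by simpa using hC)) (Or.inl ENNReal.ofReal_ne_top),
    mul_comm, ← ENNReal.ofReal_mul hC.le] at h
  refine lt_of_le_of_lt ?_ h
  rw [← ofReal_norm]
  exact ENNReal.ofReal_le_ofReal (hC' _)

/-- The space `T_m^{0,1}`: the completion of the trace polynomials in the metric `d`. -/
abbrev T01 (m : ℕ) : Type := UniformSpace.Completion (TrP0 m)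

/-- The function `V|_{M_N(ℂ)_{sa}^m}` of an element `V` of `T_m^{0,1}`: the continuous extension
of `f ↦ f(x)` from trace polynomials. -/
def T01.val {m : ℕ} (V : T01 m) {N : ℕ} (x : Tup m N) : ℂ :=
  UniformSpace.Completion.extension (fun f : TrP0 m => eval0 x f) V

/-- The gradient `DV` of an element `V` of `T_m^{0,1}` on `M_N(ℂ)_{sa}^m`: the continuous
extension of `f ↦ Df(x)` from trace polynomials. -/
def T01.gradVal {m : ℕ} (V : T01 m) {N : ℕ} (x : Tup m N) : Fin m → Mat N :=
  UniformSpace.Completion.extension (fun f : TrP0 m => evalGrad x f) V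

theorem T01.val_coe {m N : ℕ} (hN : 0 < N) (x : Tup m N) (f : TrP0 m) :
    T01.val (f : T01 m) x = eval0 x f :=
  UniformSpace.Completion.extension_coe (uniformContinuous_eval0 hN x) f

theorem T01.gradVal_coe {m N : ℕ} (hN : 0 < N) (x : Tup m N) (f : TrP0 m) :
    T01.gradVal (f : T01 m) x = evalGrad x f :=
  UniformSpace.Completion.extension_coe (uniformContinuous_evalGrad hN x) f

/-! ### Sequences of functions on matrix tuples and the elements of `T_m^{0,1}` they define -/

/-- `limsup_N sup_{‖x‖_∞ ≤ R} |φ_N(x)|`. -/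
def limNorm0 {m : ℕ} (R : ℝ) (φ : ∀ N : ℕ, Tup m N → ℂ) : ℝ≥0∞ :=
  Filter.limsup (fun N : ℕ => ⨆ (x : Tup m N) (_ : ‖x‖ ≤ R), ‖φ N x‖ₑ) Filter.atTop

/-- `limsup_N sup_{‖x‖_∞ ≤ R} ‖G_N(x)‖_2`. -/
def limNorm1 {m : ℕ} (R : ℝ) (G : ∀ N : ℕ, Tup m N → Fin m → Mat N) : ℝ≥0∞ :=
  Filter.limsup (fun N : ℕ => ⨆ (x : Tup m N) (_ : ‖x‖ ≤ R), ENNReal.ofReal (norm2 (G N x)))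
    Filter.atTop

/-- `g` is the normalized gradient of `φ` at `x`, that is, the gradient with respect to the inner
product `⟨y, h⟩_2 = ∑_j τ_N(y_j h_j)`, with values in the complexification `M_N(ℂ)^m`. -/
def HasNormalizedGradientAt {m N : ℕ} (φ : Tup m N → ℂ) (g : Fin m → Mat N) (x : Tup m N) : Prop :=
  DifferentiableAt ℝ φ x ∧ ∀ h : Tup m N, fderiv ℝ φ x h = ∑ j, ntr N (g j * (h j : Mat N))

/-- The class `[φ_•]` of the sequence `φ_•` is the element `V` of `T_m^{0,1}`: all the functions
`φ_N` are differentiable, the seminorms of `φ_•` and of the sequence `Dφ_•` of normalized gradients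
are finite, and `[φ_•] = V`, `[Dφ_•] = DV`, where two sequences are in the same class when all the
seminorms of their difference vanish. -/
def IsClassOf {m : ℕ} (φ : ∀ N : ℕ, Tup m N → ℂ) (V : T01 m) : Prop :=
  (∀ R : ℝ, limNorm0 R φ < ⊤) ∧
  (∀ R : ℝ, limNorm0 R (fun N x => φ N x - V.val x) = 0) ∧
  ∃ G : ∀ N : ℕ, Tup m N → Fin m → Mat N,
    (∀ N : ℕ, 0 < N → ∀ x : Tup m N, HasNormalizedGradientAt (φ N) (G N x) x) ∧
    (∀ R : ℝ, limNorm1 R G < ⊤) ∧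
    ∀ R : ℝ, limNorm1 R (fun N x => G N x - V.gradVal x) = 0

/-- `‖x‖_2^2 = ∑_j τ_N(x_j^2)`. -/
def sqNorm2 {m N : ℕ} (x : Tup m N) : ℝ := norm2 (fun j => (x j : Mat N)) ^ 2

/-- The class `E_m(c, C)^{0,1}` of all real-valued `V` in `T_m^{0,1}` such that
`V(x) - (c/2) ‖x‖_2^2` is convex and `V(x) - (C/2) ‖x‖_2^2` is concave on `M_N(ℂ)_{sa}^m`
for every `N ≥ 1`. -/
def E01 (m : ℕ) (c C : ℝ) : Set (T01 m) :=
  {V | ∀ N : ℕ, 0 < N →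
    (∀ x : Tup m N, (V.val x).im = 0) ∧
    ConvexOn ℝ Set.univ (fun x : Tup m N => (V.val x).re - c / 2 * sqNorm2 x) ∧
    ConcaveOn ℝ Set.univ (fun x : Tup m N => (V.val x).re - C / 2 * sqNorm2 x)}

/-! ### The potentials -/

/-- `Φ_N(x) = (φ(x_1), …, φ(x_m))`, by functional calculus. -/
def cutoff {m N : ℕ} (φ : ℝ → ℝ) (x : Tup m N) : Tup m N :=
  fun j => ⟨cfc φ (x j : Mat N), cfc_predicate φ (x j : Mat N)⟩

/-- `½ ‖x‖_2^2 + ε f(Φ_N(x))`. -/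
def potential {m : ℕ} (f : TrP0 m) (φ : ℝ → ℝ) (ε : ℝ) (N : ℕ) (x : Tup m N) : ℂ :=
  ((1 / 2 * sqNorm2 x : ℝ) : ℂ) + (ε : ℂ) * eval0 (cutoff φ x) f

end TracePoly

end

/-! Membership in the completion. Local `C¹` approximation of `φ` by real polynomials `q_k`
(`exists_polynomial_approx`) turns `f ∘ Φ_N` into honest trace polynomials: the substitution `X_j ↦
q_k(X_j)` gives `subst (q_k) f`. These are Cauchy in every seminorm, uniformly in `N`
(`cauchy_subst`). No formula for the gradient of `f ∘ Φ_N` is needed, because a gradient is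
controlled by a local Lipschitz constant in the 2-norm (`norm2_le_of_hasFDerivAt`). A scalar
Lipschitz bound is an operator Lipschitz bound in the 2-norm with the same constant
(`hs_fc_sub_fc_le`), so smallness of `q_k - q_l` in `C¹` yields small mixed differences, recorded by
`Close`, and these survive sums, products and traces. The limit agrees with the potential at every
`N ≥ 1`, and uniform convergence of derivatives identifies the gradient (`IsLimit.hasFDerivAt`), so
the class is an exact limit and not only an asymptotic one.

Convexity. It suffices to bound the second differences of `f ∘ Φ_N` in a direction `k` by `C ‖k‖_2²`
with `C` independent of `N` (`exists_second_difference_bound`): for small `ε` they are then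
dominated by those of `(δ/2) ‖x‖_2²`, and continuous midpoint convex functions are convex. The
product of two increments of finite 2-norm is controlled only in the 1-norm, so second differences
are measured in the dual of the operator norm; this is `Jet`. For `φ` itself the bound comes from
Fourier analysis: `φ ∘ tan` is smooth and periodic, hence `φ` is a rapidly convergent series in
integer powers of the Cayley transform (`exists_cayley_expansion`). The resolvent identity gives the
bound for the transform, and for its `n`-th power the constants grow only like `n²`.

Both arguments share one induction over trace polynomials, `TraceStable.exists_bound_eval0`, applied
to `Close` and to `Jet`. -/

open Filter Topology

namespace TracePoly

/-! ### The normalized Hilbert-Schmidt norm -/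

section HilbertSchmidt

variable {m N : ℕ}

/-- The normalized Hilbert-Schmidt norm `τ_N(A^* A)^{1/2}` of a matrix. -/
noncomputable def hs (A : Mat N) : ℝ := norm2 (fun _ : Fin 1 => A)

theorem ntr_apply (A : Mat N) : ntr N A = (N : ℂ)⁻¹ * A.trace := rfl

theorem ntr_mul_comm (A B : Mat N) : ntr N (A * B) = ntr N (B * A) := by
  rw [ntr_apply, ntr_apply, Matrix.trace_mul_comm]

theorem ntr_star (A : Mat N) : ntr N (star A) = star (ntr N A) := by
  simp [ntr_apply, Matrix.star_eq_conjTranspose, Matrix.trace_conjTranspose]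

theorem ntr_one (hN : 0 < N) : ntr N (1 : Mat N) = 1 := by
  have : (N : ℂ) ≠ 0 := by exact_mod_cast hN.ne'
  simp [ntr_apply, Matrix.trace_one, this]

theorem ntr_conjTranspose_mul_self (A : Mat N) :
    ntr N (A.conjTranspose * A) = (((N : ℝ)⁻¹ * ∑ a, ∑ b, ‖A b a‖ ^ 2 : ℝ) : ℂ) := by
  simp [ntr_apply, Matrix.trace, Matrix.mul_apply, Complex.conj_mul']

theorem norm2_nonneg (y : Fin m → Mat N) : 0 ≤ norm2 y := Real.sqrt_nonneg _

theorem hs_nonneg (A : Mat N) : 0 ≤ hs A := norm2_nonneg _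

theorem hs_sq (A : Mat N) : hs A ^ 2 = (N : ℝ)⁻¹ * ∑ a, ∑ b, ‖A b a‖ ^ 2 := by
  rw [hs, norm2, Real.sq_sqrt]
  · simp only [ntr_conjTranspose_mul_self, Complex.ofReal_re]
    simp
  · simp only [ntr_conjTranspose_mul_self, Complex.ofReal_re]
    positivity

theorem norm2_sq (y : Fin m → Mat N) : norm2 y ^ 2 = ∑ j, hs (y j) ^ 2 := by
  rw [norm2, Real.sq_sqrt]
  · simp only [ntr_conjTranspose_mul_self, Complex.ofReal_re, hs_sq]
  · simp only [ntr_conjTranspose_mul_self, Complex.ofReal_re]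
    positivity

theorem ntr_conjTranspose_mul_self_eq_hs (A : Mat N) :
    ntr N (A.conjTranspose * A) = ((hs A ^ 2 : ℝ) : ℂ) := by
  rw [ntr_conjTranspose_mul_self, hs_sq]

theorem hs_le_norm2 (y : Fin m → Mat N) (j : Fin m) : hs (y j) ≤ norm2 y := by
  refine le_of_sq_le_sq ?_ (norm2_nonneg _)
  rw [norm2_sq]
  exact Finset.single_le_sum (f := fun j => hs (y j) ^ 2) (fun i _ => sq_nonneg _)
    (Finset.mem_univ j)

theorem hs_add_le (A B : Mat N) : hs (A + B) ≤ hs A + hs B := norm2_add_le _ _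

theorem hs_neg (A : Mat N) : hs (-A) = hs A := norm2_neg _

theorem hs_zero : hs (0 : Mat N) = 0 := norm2_zero

theorem norm2_smul (c : ℂ) (y : Fin m → Mat N) : norm2 (c • y) = ‖c‖ * norm2 y := by
  have : (WithLp.toLp 2 fun i : Fin m × Fin N × Fin N => (c • y) i.1 i.2.1 i.2.2) =
      c • WithLp.toLp 2 fun i : Fin m × Fin N × Fin N => y i.1 i.2.1 i.2.2 := rfl
  rw [norm2_eq, norm2_eq, this, norm_smul]
  ring

theorem hs_smul (c : ℂ) (A : Mat N) : hs (c • A) = ‖c‖ * hs A := norm2_smul c _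

theorem hs_star (A : Mat N) : hs (star A) = hs A := by
  refine (sq_eq_sq₀ (hs_nonneg _) (hs_nonneg _)).1 ?_
  rw [hs_sq, hs_sq, Finset.sum_comm]
  simp [Matrix.star_apply]

/-- The squared norm is a sum over columns, and the operator norm of `A` bounds its action on each
column of `B`. -/
theorem hs_mul_le_left (A B : Mat N) : hs (A * B) ≤ ‖A‖ * hs B := by
  refine le_of_sq_le_sq ?_ (mul_nonneg (norm_nonneg _) (hs_nonneg _))
  rw [mul_pow, hs_sq, hs_sq, mul_left_comm]
  refine mul_le_mul_of_nonneg_left ?_ (by positivity)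
  rw [Finset.mul_sum]
  refine Finset.sum_le_sum fun a _ => ?_
  have h := Matrix.l2_opNorm_mulVec A (WithLp.toLp 2 fun b => B b a)
  have h2 := pow_le_pow_left₀ (norm_nonneg _) h 2
  rw [mul_pow, EuclideanSpace.norm_sq_eq, EuclideanSpace.norm_sq_eq] at h2
  simpa [Matrix.mulVec, Matrix.mul_apply, dotProduct] using h2

theorem hs_mul_le_right (A B : Mat N) : hs (A * B) ≤ hs A * ‖B‖ := by
  rw [← hs_star, star_mul, ← hs_star A, ← norm_star B, mul_comm (hs _)]
  exact hs_mul_le_left _ _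

/-- Cauchy–Schwarz for the entries of `A^*` and `B`. This is the only way in which a product of two
increments can be bounded independently of `N`. -/
theorem norm_ntr_mul_le (A B : Mat N) : ‖ntr N (A * B)‖ ≤ hs A * hs B := by
  have e : ∀ C : Mat N, hs C = Real.sqrt (N : ℝ)⁻¹ *
      ‖WithLp.toLp 2 (fun i : Fin N × Fin N => C i.1 i.2)‖ := by
    intro C
    refine (sq_eq_sq₀ (hs_nonneg _) (by positivity)).1 ?_
    rw [mul_pow, Real.sq_sqrt (by positivity), hs_sq, EuclideanSpace.norm_sq_eq,
      Fintype.sum_prod_type, Finset.sum_comm]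
  have h := norm_inner_le_norm (𝕜 := ℂ) (WithLp.toLp 2 (fun i : Fin N × Fin N => star A i.1 i.2))
    (WithLp.toLp 2 (fun i : Fin N × Fin N => B i.1 i.2))
  have h2 : ntr N (A * B) = (N : ℂ)⁻¹ *
      inner ℂ (WithLp.toLp 2 (fun i : Fin N × Fin N => star A i.1 i.2))
        (WithLp.toLp 2 (fun i : Fin N × Fin N => B i.1 i.2)) := by
    rw [ntr_apply, PiLp.inner_apply, Fintype.sum_prod_type, Finset.sum_comm]
    simp [Matrix.trace, Matrix.mul_apply, Matrix.star_apply, mul_comm]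
  rw [h2, norm_mul, ← hs_star A, e, e, mul_mul_mul_comm, Real.mul_self_sqrt (by positivity)]
  simpa using mul_le_mul_of_nonneg_left h (by positivity)

theorem hs_one (hN : 0 < N) : hs (1 : Mat N) = 1 := by
  refine (sq_eq_sq₀ (hs_nonneg _) zero_le_one).1 ?_
  have h := ntr_conjTranspose_mul_self_eq_hs (1 : Mat N)
  rw [Matrix.conjTranspose_one, one_mul, ntr_one hN] at h
  rw [one_pow]
  exact_mod_cast h.symm

theorem hs_le_norm (hN : 0 < N) (A : Mat N) : hs A ≤ ‖A‖ := by
  simpa [hs_one hN] using hs_mul_le_left A 1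

theorem norm_ntr_le_hs (hN : 0 < N) (A : Mat N) : ‖ntr N A‖ ≤ hs A := by
  simpa [hs_one hN] using norm_ntr_mul_le A 1

theorem norm_ntr_le (hN : 0 < N) (A : Mat N) : ‖ntr N A‖ ≤ ‖A‖ :=
  (norm_ntr_le_hs hN A).trans (hs_le_norm hN A)

theorem norm_one_mat (hN : 0 < N) : ‖(1 : Mat N)‖ = 1 := by
  have : Nonempty (Fin N) := ⟨⟨0, hN⟩⟩
  exact CStarRing.norm_one

end HilbertSchmidt

/-! ### Predicates that are stable under trace polynomial operations -/

section TraceStable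

variable {m N : ℕ} {ι : Type}

/-- A family of size conditions on `ι`-tuples of matrices, indexed by a bound, that is stable under
sums, products, scalars and the normalized trace. -/
structure TraceStable (P : ℝ → (ι → Mat N) → Prop) : Prop where
  const : ∀ c : ℂ, P ‖c‖ fun _ => c • 1
  add : ∀ {K L A B}, P K A → P L B → P (K + L) (A + B)
  -- The factor 4 counts the terms of the Leibniz rule for a mixed or second difference.
  mul : ∀ {K L A B}, P K A → P L B → P (4 * K * L) (A * B)
  trace : ∀ {K A}, P K A → P K fun i => ntr N (A i) • 1

theorem eval0_tr (x : Tup m N) (p : NCP m) : eval0 x (tr p) = ntr N (evalNCP x p) := by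
  simp [eval0, tr, descend]

@[elab_as_elim]
theorem TrP0.induction {motive : TrP0 m → Prop}
    (scalar : ∀ c : ℂ, motive (algebraMap ℂ (TrP0 m) c))
    (tr : ∀ p : NCP m, motive (tr p)) (mul : ∀ f g, motive f → motive g → motive (f * g))
    (add : ∀ f g, motive f → motive g → motive (f + g)) (f : TrP0 m) : motive f := by
  refine SymmetricAlgebra.induction ℂ (CyclicNCP m) scalar (fun p => ?_) mul add f
  obtain ⟨p, rfl⟩ := Submodule.mkQ_surjective _ p
  exact tr p

/-- The order of the quantifiers is the point: `K'` is fixed before the dimension and the predicate,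
so one constant serves all `N` and all parameters hidden in `P`. -/
theorem TraceStable.exists_bound_evalNCP (p : NCP m) (K : ℝ) :
    ∃ K' : ℝ, ∀ N : ℕ, 0 < N → ∀ P : ℝ → (ι → Mat N) → Prop, TraceStable P →
      ∀ X : ι → Tup m N, (∀ j, P K fun i => (X i j : Mat N)) →
        P K' fun i => evalNCP (X i) p := by
  induction p using FreeAlgebra.induction with
  | grade0 c =>
    refine ⟨‖c‖, fun N hN P hP X hX => ?_⟩
    simpa [Algebra.algebraMap_eq_smul_one] using hP.const c
  | grade1 j =>
    refine ⟨K, fun N hN P hP X hX => ?_⟩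
    simpa [evalNCP] using hX j
  | mul a b ha hb =>
    obtain ⟨Ka, ha⟩ := ha
    obtain ⟨Kb, hb⟩ := hb
    refine ⟨4 * Ka * Kb, fun N hN P hP X hX => ?_⟩
    simpa [Pi.mul_def] using hP.mul (ha N hN P hP X hX) (hb N hN P hP X hX)
  | add a b ha hb =>
    obtain ⟨Ka, ha⟩ := ha
    obtain ⟨Kb, hb⟩ := hb
    refine ⟨Ka + Kb, fun N hN P hP X hX => ?_⟩
    simpa [Pi.add_def] using hP.add (ha N hN P hP X hX) (hb N hN P hP X hX)

theorem TraceStable.exists_bound_eval0 (f : TrP0 m) (K : ℝ) :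
    ∃ K' : ℝ, ∀ N : ℕ, 0 < N → ∀ P : ℝ → (ι → Mat N) → Prop, TraceStable P →
      ∀ X : ι → Tup m N, (∀ j, P K fun i => (X i j : Mat N)) →
        P K' fun i => eval0 (X i) f • 1 := by
  induction f using TrP0.induction with
  | scalar c =>
    refine ⟨‖c‖, fun N hN P hP X hX => ?_⟩
    simpa using hP.const c
  | tr p =>
    obtain ⟨K', h⟩ := TraceStable.exists_bound_evalNCP (ι := ι) p K
    refine ⟨K', fun N hN P hP X hX => ?_⟩
    simpa [eval0_tr] using hP.trace (h N hN P hP X hX)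
  | mul a b ha hb =>
    obtain ⟨Ka, ha⟩ := ha
    obtain ⟨Kb, hb⟩ := hb
    refine ⟨4 * Ka * Kb, fun N hN P hP X hX => ?_⟩
    simpa [Pi.mul_def, smul_smul, mul_comm] using
      hP.mul (ha N hN P hP X hX) (hb N hN P hP X hX)
  | add a b ha hb =>
    obtain ⟨Ka, ha⟩ := ha
    obtain ⟨Kb, hb⟩ := hb
    refine ⟨Ka + Kb, fun N hN P hP X hX => ?_⟩
    simpa [Pi.add_def, add_smul] using hP.add (ha N hN P hP X hX) (hb N hN P hP X hX)

end TraceStable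

/-! ### Mixed first differences -/

section Close

variable {N : ℕ}

/-- The pairs `(A 0, A 1)` and `(A 2, A 3)` are bounded, have `2`-norm increments controlled by
`d`, are `η`-close in operator norm and have increments that are `η d`-close in `2`-norm. -/
structure Close (η d K : ℝ) (A : Fin 4 → Mat N) : Prop where
  norm_le : ∀ i, ‖A i‖ ≤ K
  norm_sub₀ : ‖A 0 - A 2‖ ≤ η * K
  norm_sub₁ : ‖A 1 - A 3‖ ≤ η * K
  hs_sub₀ : hs (A 1 - A 0) ≤ K * d
  hs_sub₂ : hs (A 3 - A 2) ≤ K * d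
  hs_mixed : hs (A 1 - A 3 - (A 0 - A 2)) ≤ η * K * d

theorem Close.traceStable (hN : 0 < N) {η d : ℝ} (hη : 0 ≤ η) (hd : 0 ≤ d) :
    TraceStable (N := N) (Close η d) where
  const c := by
    constructor <;> simp [norm_smul, norm_one_mat hN, hs_zero] <;> positivity
  add {K L A B} hA hB := by
    constructor
    · intro i
      exact (norm_add_le _ _).trans (add_le_add (hA.1 i) (hB.1 i))
    · simp only [Pi.add_apply, add_sub_add_comm, mul_add]
      exact (norm_add_le _ _).trans (add_le_add hA.2 hB.2)
    · simp only [Pi.add_apply, add_sub_add_comm, mul_add]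
      exact (norm_add_le _ _).trans (add_le_add hA.3 hB.3)
    · simp only [Pi.add_apply, add_sub_add_comm, add_mul]
      exact (hs_add_le _ _).trans (add_le_add hA.4 hB.4)
    · simp only [Pi.add_apply, add_sub_add_comm, add_mul]
      exact (hs_add_le _ _).trans (add_le_add hA.5 hB.5)
    · simp only [Pi.add_apply, add_sub_add_comm, mul_add, add_mul]
      exact (hs_add_le _ _).trans (add_le_add hA.6 hB.6)
  mul {K L A B} hA hB := by
    have hK : 0 ≤ K := (norm_nonneg _).trans (hA.1 0)
    have hL : 0 ≤ L := (norm_nonneg _).trans (hB.1 0)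
    have hKL : 0 ≤ K * L := mul_nonneg hK hL
    have nn : ∀ {X Y : Mat N} {a b : ℝ}, 0 ≤ a → ‖X‖ ≤ a → ‖Y‖ ≤ b → ‖X * Y‖ ≤ a * b :=
      fun h hX hY => (norm_mul_le _ _).trans (mul_le_mul hX hY (norm_nonneg _) h)
    have nh : ∀ {X Y : Mat N} {a b : ℝ}, 0 ≤ a → ‖X‖ ≤ a → hs Y ≤ b → hs (X * Y) ≤ a * b :=
      fun h hX hY => (hs_mul_le_left _ _).trans (mul_le_mul hX hY (hs_nonneg _) h)
    have hn : ∀ {X Y : Mat N} {a b : ℝ}, 0 ≤ a → hs X ≤ a → ‖Y‖ ≤ b → hs (X * Y) ≤ a * b :=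
      fun h hX hY => (hs_mul_le_right _ _).trans (mul_le_mul hX hY (norm_nonneg _) h)
    have e : ∀ a b c d : Mat N, a * b - c * d = (a - c) * b + c * (b - d) := by
      intros; noncomm_ring
    have hηKL : 0 ≤ η * (K * L) := mul_nonneg hη hKL
    have hdKL : 0 ≤ d * (K * L) := mul_nonneg hd hKL
    have hη' : 0 ≤ η * K := mul_nonneg hη hK
    have hd' : 0 ≤ K * d := mul_nonneg hK hd
    constructor
    · intro i
      refine (nn hK (hA.1 i) (hB.1 i)).trans (by linarith)
    · simp only [Pi.mul_apply]
      rw [e]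
      refine (norm_add_le _ _).trans ((add_le_add (nn hη' hA.2 (hB.1 0))
        (nn hK (hA.1 2) hB.2)).trans (by linarith))
    · simp only [Pi.mul_apply]
      rw [e]
      refine (norm_add_le _ _).trans ((add_le_add (nn hη' hA.3 (hB.1 1))
        (nn hK (hA.1 3) hB.3)).trans (by linarith))
    · simp only [Pi.mul_apply]
      rw [e]
      refine (hs_add_le _ _).trans ((add_le_add (hn hd' hA.4 (hB.1 1))
        (nh hK (hA.1 0) hB.4)).trans (by linarith))
    · simp only [Pi.mul_apply]
      rw [e]
      refine (hs_add_le _ _).trans ((add_le_add (hn hd' hA.5 (hB.1 3))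
        (nh hK (hA.1 2) hB.5)).trans (by linarith))
    · simp only [Pi.mul_apply]
      -- In each of the four terms exactly one factor is measured in 2-norm and the other in
      -- operator norm, and each term collects `η` and `d` once.
      have e2 : A 1 * B 1 - A 3 * B 3 - (A 0 * B 0 - A 2 * B 2) =
          ((A 1 - A 3 - (A 0 - A 2)) * B 1 + (A 0 - A 2) * (B 1 - B 0)) +
          ((A 3 - A 2) * (B 1 - B 3) + A 2 * (B 1 - B 3 - (B 0 - B 2))) := by
        noncomm_ring
      rw [e2]
      have h1 := hn (by positivity) hA.6 (hB.1 1)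
      have h2 := nh hη' hA.2 hB.4
      have h3 := hn hd' hA.5 hB.3
      have h4 := nh hK (hA.1 2) hB.6
      refine (hs_add_le _ _).trans ((add_le_add ((hs_add_le _ _).trans (add_le_add h1 h2))
        ((hs_add_le _ _).trans (add_le_add h3 h4))).trans (le_of_eq (by ring)))
  trace {K A} hA := by
    have key : ∀ {X : Mat N} {a : ℝ}, ‖X‖ ≤ a → ‖ntr N X • (1 : Mat N)‖ ≤ a := by
      intro X a h
      rw [norm_smul, norm_one_mat hN, mul_one]
      exact (norm_ntr_le hN X).trans h
    have key2 : ∀ {X : Mat N} {a : ℝ}, hs X ≤ a → hs (ntr N X • (1 : Mat N)) ≤ a := by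
      intro X a h
      rw [hs_smul, hs_one hN, mul_one]
      exact (norm_ntr_le_hs hN X).trans h
    constructor
    · exact fun i => key (hA.1 i)
    all_goals simp only [← sub_smul, ← map_sub]
    exacts [key hA.2, key hA.3, key2 hA.4, key2 hA.5, key2 hA.6]

end Close

/-! ### Second differences -/

section Jet

variable {N : ℕ}

/-- `A 0`, `A 1` and `A 2` are bounded by `a`, the increments `A 1 - A 0` and `A 2 - A 0` are
bounded by `b d` in `2`-norm, and the second difference `A 1 + A 2 - 2 A 0` is bounded by `c d ^ 2`
in the dual of the operator norm. -/
structure Jet (d a b c : ℝ) (A : Fin 3 → Mat N) : Prop where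
  norm_le : ∀ i, ‖A i‖ ≤ a
  hs_sub : ∀ i, hs (A i - A 0) ≤ b * d
  second : ∀ B : Mat N, ‖ntr N (B * (A 1 + A 2 - (2 : ℂ) • A 0))‖ ≤ c * d ^ 2 * ‖B‖

theorem Jet.add {d a b c a' b' c' : ℝ} {A B : Fin 3 → Mat N} (hA : Jet d a b c A)
    (hB : Jet d a' b' c' B) : Jet d (a + a') (b + b') (c + c') (A + B) := by
  constructor
  · exact fun i => (norm_add_le _ _).trans (add_le_add (hA.1 i) (hB.1 i))
  · intro i
    simp only [Pi.add_apply, add_sub_add_comm, add_mul]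
    exact (hs_add_le _ _).trans (add_le_add (hA.2 i) (hB.2 i))
  · intro M
    have e : M * ((A + B) 1 + (A + B) 2 - (2 : ℂ) • (A + B) 0) =
        M * (A 1 + A 2 - (2 : ℂ) • A 0) + M * (B 1 + B 2 - (2 : ℂ) • B 0) := by
      simp only [Pi.add_apply, smul_add, ← mul_add]
      congr 1
      abel
    rw [e, map_add, add_mul, add_mul]
    exact (norm_add_le _ _).trans (add_le_add (hA.3 M) (hB.3 M))

theorem Jet.smul {d a b c : ℝ} {A : Fin 3 → Mat N} (k : ℂ) (hA : Jet d a b c A) :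
    Jet d (‖k‖ * a) (‖k‖ * b) (‖k‖ * c) (k • A) := by
  constructor
  · intro i
    rw [Pi.smul_apply, norm_smul]
    exact mul_le_mul_of_nonneg_left (hA.1 i) (norm_nonneg _)
  · intro i
    rw [Pi.smul_apply, Pi.smul_apply, ← smul_sub, hs_smul, mul_assoc]
    exact mul_le_mul_of_nonneg_left (hA.2 i) (norm_nonneg _)
  · intro M
    have e : M * ((k • A) 1 + (k • A) 2 - (2 : ℂ) • (k • A) 0) =
        k • (M * (A 1 + A 2 - (2 : ℂ) • A 0)) := by
      simp only [Pi.smul_apply, smul_comm (2 : ℂ) k, ← smul_add, ← smul_sub, mul_smul_comm]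
    rw [e, map_smul, norm_smul, mul_assoc, mul_assoc, ← mul_assoc c]
    exact mul_le_mul_of_nonneg_left (hA.3 M) (norm_nonneg _)

theorem Jet.one (hN : 0 < N) {d : ℝ} : Jet d 1 0 0 (1 : Fin 3 → Mat N) := by
  constructor
  · simp [norm_one_mat hN]
  · simp [hs_zero]
  · intro M
    have : (1 : Mat N) + 1 - (2 : ℂ) • 1 = 0 := by rw [two_smul, sub_self]
    simp [this]

/-- Leibniz rule for second differences. Cyclicity of the trace absorbs the outer factors into the
test matrix, and the products of two increments, one from each factor, are handled by
Cauchy–Schwarz; this is what forces the dual norm. -/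
theorem Jet.mul {d a b c a' b' c' : ℝ} (hd : 0 ≤ d) (hb : 0 ≤ b) (hc : 0 ≤ c) (hc' : 0 ≤ c')
    {A B : Fin 3 → Mat N}
    (hA : Jet d a b c A) (hB : Jet d a' b' c' B) :
    Jet d (a * a') (b * a' + a * b') (c * a' + a * c' + 2 * b * b') (A * B) := by
  have ha : 0 ≤ a := (norm_nonneg _).trans (hA.1 0)
  have hbd : 0 ≤ b * d := mul_nonneg hb hd
  constructor
  · exact fun i => (norm_mul_le _ _).trans
      (mul_le_mul (hA.1 i) (hB.1 i) (norm_nonneg _) ha)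
  · intro i
    have e : A i * B i - A 0 * B 0 = (A i - A 0) * B i + A 0 * (B i - B 0) := by noncomm_ring
    simp only [Pi.mul_apply]
    rw [e]
    have h1 := (hs_mul_le_right (A i - A 0) (B i)).trans
      (mul_le_mul (hA.2 i) (hB.1 i) (norm_nonneg _) hbd)
    have h2 := (hs_mul_le_left (A 0) (B i - B 0)).trans
      (mul_le_mul (hA.1 0) (hB.2 i) (hs_nonneg _) ha)
    exact (hs_add_le _ _).trans ((add_le_add h1 h2).trans (le_of_eq (by ring)))
  · intro M
    have e : M * ((A * B) 1 + (A * B) 2 - (2 : ℂ) • (A * B) 0) =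
        M * (A 1 + A 2 - (2 : ℂ) • A 0) * B 0 + M * A 0 * (B 1 + B 2 - (2 : ℂ) • B 0) +
        (M * (A 1 - A 0) * (B 1 - B 0) + M * (A 2 - A 0) * (B 2 - B 0)) := by
      simp only [Pi.mul_apply, two_smul]
      noncomm_ring
    rw [e, map_add, map_add, map_add, ntr_mul_comm _ (B 0), ← mul_assoc]
    have h1 := hA.3 (B 0 * M)
    have h2 := hB.3 (M * A 0)
    have n1 : ‖B 0 * M‖ ≤ a' * ‖M‖ :=
      (norm_mul_le _ _).trans (mul_le_mul_of_nonneg_right (hB.1 0) (norm_nonneg _))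
    have n2 : ‖M * A 0‖ ≤ a * ‖M‖ := by
      rw [mul_comm a]
      exact (norm_mul_le _ _).trans (mul_le_mul_of_nonneg_left (hA.1 0) (norm_nonneg _))
    have h3 : ∀ i, ‖ntr N (M * (A i - A 0) * (B i - B 0))‖ ≤ ‖M‖ * (b * d) * (b' * d) := by
      intro i
      refine (norm_ntr_mul_le _ _).trans (mul_le_mul ?_ (hB.2 i) (hs_nonneg _) (by positivity))
      exact (hs_mul_le_left _ _).trans (mul_le_mul_of_nonneg_left (hA.2 i) (norm_nonneg _))
    have h1' := h1.trans (mul_le_mul_of_nonneg_left n1 (by positivity))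
    have h2' := h2.trans (mul_le_mul_of_nonneg_left n2 (by positivity))
    refine (norm_add_le _ _).trans ((add_le_add ((norm_add_le _ _).trans (add_le_add h1' h2'))
      ((norm_add_le _ _).trans (add_le_add (h3 1) (h3 2)))).trans (le_of_eq (by ring)))

theorem Jet.mono {d a b c a' b' c' : ℝ} (hd : 0 ≤ d) {A : Fin 3 → Mat N} (hA : Jet d a b c A)
    (ha : a ≤ a') (hb : b ≤ b') (hc : c ≤ c') : Jet d a' b' c' A :=
  ⟨fun i => (hA.1 i).trans ha, fun i => (hA.2 i).trans (by gcongr),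
    fun B => (hA.3 B).trans (by gcongr)⟩

theorem Jet.traceStable (hN : 0 < N) {d : ℝ} (hd : 0 ≤ d) :
    TraceStable (N := N) fun K => Jet d K K K where
  const c := by
    refine ((Jet.one hN (d := d)).smul c).mono hd ?_ ?_ ?_ <;> simp
  add hA hB := hA.add hB
  mul {K L A B} hA hB := by
    have hK : 0 ≤ K := (norm_nonneg _).trans (hA.1 0)
    have hL : 0 ≤ L := (norm_nonneg _).trans (hB.1 0)
    have hKL : 0 ≤ K * L := mul_nonneg hK hL
    refine (Jet.mul hd hK hK hL hA hB).mono hd ?_ ?_ ?_ <;> linarith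
  trace {K A} hA := by
    have hK : 0 ≤ K := (norm_nonneg _).trans (hA.1 0)
    constructor
    · intro i
      rw [norm_smul, norm_one_mat hN, mul_one]
      exact (norm_ntr_le hN _).trans (hA.1 i)
    · intro i
      rw [← sub_smul, ← map_sub, hs_smul, hs_one hN, mul_one]
      exact (norm_ntr_le_hs hN _).trans (hA.2 i)
    · intro M
      have e : M * (ntr N (A 1) • 1 + ntr N (A 2) • 1 - (2 : ℂ) • ntr N (A 0) • (1 : Mat N)) =
          ntr N (A 1 + A 2 - (2 : ℂ) • A 0) • M := by
        rw [map_sub, map_add, map_smul, smul_smul, ← add_smul, ← sub_smul, mul_smul_comm, mul_one,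
          smul_eq_mul]
      -- The second difference is a scalar multiple of the identity, so testing against `1` already
      -- gives its size.
      have h := hA.3 1
      rw [one_mul, norm_one_mat hN, mul_one] at h
      rw [e, map_smul, norm_smul]
      exact mul_le_mul h (norm_ntr_le hN M) (norm_nonneg _) (by positivity)

end Jet

/-! ### Gradients of trace polynomials -/

section Gradient

variable {m N : ℕ}

/-- The normalized trace as a continuous real-linear map. -/
noncomputable def ntrL (N : ℕ) : Mat N →L[ℝ] ℂ :=
  ((ntr N).restrictScalars ℝ).toContinuousLinearMap

theorem ntrL_apply (A : Mat N) : ntrL N A = ntr N A := rfl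

/-- The `j`-th coordinate of a tuple of self-adjoint matrices. -/
noncomputable def coordL (j : Fin m) : Tup m N →L[ℝ] Mat N :=
  LinearMap.mkContinuous
    { toFun := fun x => (x j : Mat N)
      map_add' := fun _ _ => rfl
      map_smul' := fun _ _ => rfl } 1 fun x => by
    rw [one_mul]
    exact norm_le_pi_norm x j

theorem coordL_apply (j : Fin m) (x : Tup m N) : coordL j x = (x j : Mat N) := rfl

/-- The linear functional `h ↦ ∑_j τ_N(g_j h_j)`. -/
noncomputable def pairing (g : Fin m → Mat N) : Tup m N →L[ℝ] ℂ :=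
  ∑ j, (ntrL N ∘L ContinuousLinearMap.mul ℝ (Mat N) (g j)) ∘L coordL j

theorem pairing_apply (g : Fin m → Mat N) (h : Tup m N) :
    pairing g h = ∑ j, ntr N (g j * (h j : Mat N)) := by
  simp [pairing, ntrL_apply, coordL_apply]

theorem pairing_add (g g' : Fin m → Mat N) : pairing (g + g') = pairing g + pairing g' := by
  ext h
  simp [pairing_apply, add_mul, Finset.sum_add_distrib]

theorem pairing_smul (c : ℂ) (g : Fin m → Mat N) : pairing (c • g) = c • pairing g := by
  ext h
  simp [pairing_apply, Finset.mul_sum]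

theorem pairing_sub (g g' : Fin m → Mat N) : pairing (g - g') = pairing g - pairing g' := by
  ext h
  simp [pairing_apply, sub_mul, Finset.sum_sub_distrib]

theorem hasNormalizedGradientAt_iff {φ : Tup m N → ℂ} {g : Fin m → Mat N} {x : Tup m N} :
    HasNormalizedGradientAt φ g x ↔ HasFDerivAt φ (pairing g) x := by
  constructor
  · rintro ⟨h, h'⟩
    have : fderiv ℝ φ x = pairing g := by
      ext k
      rw [h', pairing_apply]
    exact this ▸ h.hasFDerivAt
  · intro h
    exact ⟨h.differentiableAt, fun k => by rw [h.fderiv, pairing_apply]⟩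

theorem evalNCP_word (x : Tup m N) (w : List (Fin m)) :
    evalNCP x (word w) = (w.map fun j => (x j : Mat N)).prod := by
  simp [evalNCP, word, map_list_prod, List.map_map, Function.comp_def]

theorem eval1_smul (x : Tup m N) (f : TrP0 m) (t : TrP1 m) :
    eval1 x (f • t) = eval0 x f • eval1 x t := by
  induction t using TensorProduct.induction_on with
  | zero => simp
  | tmul g p => simp [eval1, TensorProduct.smul_tmul', mul_smul]
  | add s t hs ht => rw [smul_add, map_add, hs, ht, map_add, smul_add]

theorem evalGrad_tr (x : Tup m N) (p : NCP m) (j : Fin m) :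
    evalGrad x (tr p) j = evalNCP x (cyclicDeriv j p) := by
  simp [evalGrad, grad_tr, eval1]

theorem evalGrad_mul (x : Tup m N) (f g : TrP0 m) :
    evalGrad x (f * g) = eval0 x f • evalGrad x g + eval0 x g • evalGrad x f := by
  ext1 j
  simp [evalGrad, grad_mul, eval1_smul]

theorem evalGrad_algebraMap (x : Tup m N) (c : ℂ) :
    evalGrad x (algebraMap ℂ (TrP0 m) c) = 0 := by
  ext1 j
  have : grad j (1 : TrP0 m) = 0 := by
    have h := grad_mul j (1 : TrP0 m) 1
    rw [mul_one, one_smul] at h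
    exact left_eq_add.1 h
  simp [evalGrad, Algebra.algebraMap_eq_smul_one, this]

/-- The product rule inserts the direction at position `k` of the word; cyclicity of the trace
rotates it to the end, leaving the `k`-th summand of the cyclic derivative for the letter `w_k`. -/
theorem hasFDerivAt_eval0_word (x : Tup m N) (w : List (Fin m)) :
    HasFDerivAt (fun x : Tup m N => eval0 x (tr (word w))) (pairing (evalGrad x (tr (word w)))) x := by
  have hc : ∀ j, HasFDerivAt (𝕜 := ℝ) (fun x : Tup m N => (x j : Mat N)) (coordL j) x :=
    fun j => ContinuousLinearMap.hasFDerivAt (𝕜 := ℝ) (E := Tup m N) (F := Mat N) (coordL j)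
  have h1 := (ntrL N).hasFDerivAt.comp x (HasFDerivAt.list_prod' (𝕜 := ℝ) (E := Tup m N)
    (𝔸 := Mat N) (l := w) fun j _ => hc j)
  have h2 : (fun x : Tup m N => eval0 x (tr (word w))) =
      ntrL N ∘ fun x : Tup m N => (w.map fun j => (x j : Mat N)).prod := by
    funext y
    rw [eval0_tr, evalNCP_word]
    rfl
  rw [h2]
  refine h1.congr_fderiv ?_
  ext h
  rw [pairing_apply]
  simp only [evalGrad_tr, cyclicDeriv_word, cyclicDerivWord, map_sum, Finset.sum_mul]
  rw [Finset.sum_comm]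
  simp only [ContinuousLinearMap.comp_apply, sum_apply, map_sum]
  refine Finset.sum_congr rfl fun k _ => ?_
  rw [Finset.sum_eq_single (w.get k) (fun j _ hj => by rw [if_neg hj.symm, map_zero, zero_mul, map_zero])
    (fun hj => absurd (Finset.mem_univ _) hj), if_pos rfl, evalNCP_word, List.map_append,
    List.prod_append, mul_assoc, ntr_mul_comm]
  simp [ntrL_apply, coordL_apply, mul_assoc]

theorem hasFDerivAt_eval0 (f : TrP0 m) (x : Tup m N) :
    HasFDerivAt (fun x : Tup m N => eval0 x f) (pairing (evalGrad x f)) x := by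
  have h0 : pairing (0 : Fin m → Mat N) = 0 := by
    ext h
    simp [pairing_apply]
  have hadd : ∀ a b : TrP0 m,
      HasFDerivAt (fun x : Tup m N => eval0 x a) (pairing (evalGrad x a)) x →
      HasFDerivAt (fun x : Tup m N => eval0 x b) (pairing (evalGrad x b)) x →
      HasFDerivAt (fun x : Tup m N => eval0 x (a + b)) (pairing (evalGrad x (a + b))) x := by
    intro a b ha hb
    simp only [map_add, pairing_add]
    exact HasFDerivAt.fun_add (𝕜 := ℝ) (E := Tup m N) (F := ℂ) ha hb
  induction f using TrP0.induction with
  | scalar c =>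
    simp only [evalGrad_algebraMap, h0, AlgHom.commutes]
    exact hasFDerivAt_const (𝕜 := ℝ) c x
  | tr p =>
    have hp := (FreeAlgebra.basisFreeMonoid ℂ (Fin m)).mem_span p
    induction hp using Submodule.span_induction with
    | mem q hq =>
      obtain ⟨w, rfl⟩ := hq
      rw [basis_eq_word]
      exact hasFDerivAt_eval0_word x _
    | zero =>
      simp only [map_zero, h0]
      exact hasFDerivAt_const (𝕜 := ℝ) (0 : ℂ) x
    | add a b _ _ ha hb =>
      rw [map_add]
      exact hadd _ _ ha hb
    | smul c a _ ha =>
      simp only [map_smul, pairing_smul]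
      exact HasFDerivAt.fun_const_smul (𝕜 := ℝ) (E := Tup m N) (F := ℂ) ha c
  | mul f g hf hg =>
    simp only [map_mul, evalGrad_mul, pairing_add, pairing_smul]
    exact HasFDerivAt.fun_mul (𝕜 := ℝ) (E := Tup m N) (𝔸' := ℂ) hf hg
  | add f g hf hg => exact hadd _ _ hf hg

theorem ntr_mul_im_eq_zero {a b : Mat N} (ha : star a = a) (hb : star b = b) :
    (ntr N (a * b)).im = 0 := by
  rw [← Complex.conj_eq_iff_im]
  change star _ = _
  rw [← ntr_star, star_mul, ha, hb, ntr_mul_comm]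

/-- Test the functional on the direction `Re g`: the part coming from `Im g` is purely imaginary, so
the real part of the value is `‖Re g‖_2²`. -/
theorem norm2_realPart_le (g : Fin m → Mat N) {C : ℝ} (hC : 0 ≤ C)
    (h : ∀ k : Tup m N, ‖pairing g k‖ ≤ C * norm2 fun j => (k j : Mat N)) :
    norm2 (fun j => (realPart (g j) : Mat N)) ≤ C := by
  set a : Tup m N := fun j => realPart (g j) with ha
  have h1 : (pairing g a).re = norm2 (fun j => (a j : Mat N)) ^ 2 := by
    rw [norm2_sq, pairing_apply, Complex.re_sum]
    refine Finset.sum_congr rfl fun j _ => ?_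
    have hstar : star (a j : Mat N) = a j := (a j).2
    have hsa : ntr N ((a j : Mat N) * a j) = ((hs (a j : Mat N) ^ 2 : ℝ) : ℂ) := by
      rw [← ntr_conjTranspose_mul_self_eq_hs, ← Matrix.star_eq_conjTranspose, hstar]
    have him : (ntr N ((imaginaryPart (g j) : Mat N) * a j)).im = 0 :=
      ntr_mul_im_eq_zero (imaginaryPart (g j)).2 hstar
    conv_lhs => rw [← realPart_add_I_smul_imaginaryPart (g j)]
    rw [add_mul, map_add, smul_mul_assoc, map_smul, Complex.add_re, smul_eq_mul, Complex.mul_re,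
      him, show (realPart (g j) : Mat N) = a j from rfl, hsa, Complex.ofReal_re]
    simp
  have h2 := (Complex.re_le_norm _).trans (h a)
  rw [h1, pow_two] at h2
  rcases (norm2_nonneg fun j => (a j : Mat N)).eq_or_lt with h0 | h0
  · exact h0.symm.le.trans hC
  · exact le_of_mul_le_mul_right h2 h0

/-- A bound for a functional on self-adjoint directions bounds its complexified gradient. -/
theorem norm2_le_of_pairing_le (g : Fin m → Mat N) {C : ℝ} (hC : 0 ≤ C)
    (h : ∀ k : Tup m N, ‖pairing g k‖ ≤ C * norm2 fun j => (k j : Mat N)) :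
    norm2 g ≤ 2 * C := by
  have h1 := norm2_realPart_le g hC h
  -- The imaginary part of `g` is the real part of `-i g`; adding the two bounds gives the factor 2.
  have h2 := norm2_realPart_le (-Complex.I • g) hC fun k => by
    rw [pairing_smul, smul_apply, norm_smul, norm_neg, Complex.norm_I, one_mul]
    exact h k
  have e : g = (fun j => (realPart (g j) : Mat N)) +
      Complex.I • fun j => (realPart ((-Complex.I • g) j) : Mat N) := by
    ext1 j
    have : (realPart ((-Complex.I • g) j)) = imaginaryPart (g j) := by
      rw [Pi.smul_apply, neg_smul, map_neg, realPart_I_smul, neg_neg]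
    rw [Pi.add_apply, Pi.smul_apply]
    rw [this]
    exact (realPart_add_I_smul_imaginaryPart (g j)).symm
  rw [e]
  refine (norm2_add_le _ _).trans ?_
  rw [norm2_smul, Complex.norm_I, one_mul]
  linarith

/-- A local Lipschitz bound in the `2`-norm bounds the normalized gradient. -/
theorem norm2_le_of_hasFDerivAt {φ : Tup m N → ℂ} {g : Fin m → Mat N} {x : Tup m N}
    (hφ : HasFDerivAt φ (pairing g) x) {C : ℝ} (hC : 0 ≤ C)
    (h : ∀ᶠ y in 𝓝 x, ‖φ y - φ x‖ ≤ C * norm2 fun j => ((y j : Mat N) - (x j : Mat N))) :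
    norm2 g ≤ 2 * C := by
  refine norm2_le_of_pairing_le g hC fun k => ?_
  have hlim := (HasFDerivAt.hasLineDerivAt (𝕜 := ℝ) (E := Tup m N) (F := ℂ) hφ k).tendsto_slope_zero_right
  have hcont : Tendsto (fun t : ℝ => x + t • k) (𝓝[>] 0) (𝓝 x) := by
    have : Continuous fun t : ℝ => x + t • k := by fun_prop
    simpa using (this.tendsto 0).mono_left nhdsWithin_le_nhds
  refine le_of_tendsto hlim.norm ?_
  filter_upwards [hcont.eventually h, self_mem_nhdsWithin] with t ht ht0
  have ht0 : 0 < t := ht0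
  have e : (fun j => ((x + t • k) j : Mat N) - (x j : Mat N)) =
      (t : ℂ) • fun j => (k j : Mat N) := by
    ext1 j
    simp
  rw [e, norm2_smul, Complex.norm_real, Real.norm_of_nonneg ht0.le] at ht
  rw [norm_smul, norm_inv, Real.norm_of_nonneg ht0.le, inv_mul_le_iff₀ ht0]
  linarith

end Gradient

/-! ### Complex functional calculus for self-adjoint matrices -/

section FunctionalCalculus

variable {N : ℕ}

theorem isHermitian_coe (x : selfAdjoint (Mat N)) : (x : Mat N).IsHermitian := x.2

/-- The eigenvalues of a self-adjoint matrix. -/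
noncomputable def eig (x : selfAdjoint (Mat N)) : Fin N → ℝ := (isHermitian_coe x).eigenvalues

/-- A unitary that diagonalizes a self-adjoint matrix. -/
noncomputable def eigU (x : selfAdjoint (Mat N)) : Mat N := (isHermitian_coe x).eigenvectorUnitary

theorem star_eigU_mul (x : selfAdjoint (Mat N)) : star (eigU x) * eigU x = 1 :=
  Unitary.coe_star_mul_self (isHermitian_coe x).eigenvectorUnitary

theorem eigU_mul_star (x : selfAdjoint (Mat N)) : eigU x * star (eigU x) = 1 :=
  Unitary.coe_mul_star_self (isHermitian_coe x).eigenvectorUnitary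

theorem norm_eigU_le (x : selfAdjoint (Mat N)) (hN : 0 < N) : ‖eigU x‖ ≤ 1 := by
  have h := CStarRing.norm_star_mul_self (x := eigU x)
  rw [star_eigU_mul, norm_one_mat hN] at h
  nlinarith [norm_nonneg (eigU x)]

theorem norm_star_eigU_le (x : selfAdjoint (Mat N)) (hN : 0 < N) : ‖star (eigU x)‖ ≤ 1 := by
  rw [norm_star]
  exact norm_eigU_le x hN

/-- The functional calculus `g ↦ g(x)` for arbitrary complex functions on the real line. -/
noncomputable def fc (x : selfAdjoint (Mat N)) : (ℝ → ℂ) →ₐ[ℂ] Mat N where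
  toFun g := eigU x * Matrix.diagonal (fun i => g (eig x i)) * star (eigU x)
  map_one' := by
    simp only [Pi.one_apply]
    rw [Matrix.diagonal_one, mul_one, eigU_mul_star]
  map_mul' g h := by
    simp only [Pi.mul_apply]
    rw [← Matrix.diagonal_mul_diagonal]
    simp only [mul_assoc]
    rw [← mul_assoc (star (eigU x)) (eigU x), star_eigU_mul, one_mul]
  map_zero' := by
    simp
  map_add' g h := by
    simp only [Pi.add_apply]
    rw [← Matrix.diagonal_add, mul_add, add_mul]
  commutes' c := by
    simp only [Pi.algebraMap_apply, Algebra.algebraMap_self, RingHom.id_apply]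
    have : Matrix.diagonal (fun _ : Fin N => c) = algebraMap ℂ (Mat N) c := rfl
    rw [this, ← Algebra.commutes, mul_assoc, eigU_mul_star, mul_one]

theorem fc_apply (x : selfAdjoint (Mat N)) (g : ℝ → ℂ) :
    fc x g = eigU x * Matrix.diagonal (fun i => g (eig x i)) * star (eigU x) := rfl

theorem cfc_eq_fc (x : selfAdjoint (Mat N)) (g : ℝ → ℝ) :
    cfc g (x : Mat N) = fc x fun t => (g t : ℂ) := by
  rw [(isHermitian_coe x).cfc_eq]
  rfl

theorem fc_ofReal (x : selfAdjoint (Mat N)) : fc x (fun t => (t : ℂ)) = x := by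
  exact (isHermitian_coe x).spectral_theorem.symm

theorem fc_aeval (x : selfAdjoint (Mat N)) (p : Polynomial ℂ) :
    fc x (fun t => p.eval (t : ℂ)) = Polynomial.aeval (x : Mat N) p := by
  conv_rhs => rw [← fc_ofReal x]
  rw [Polynomial.aeval_algHom_apply]
  congr 1
  funext t
  simp

theorem norm_fc_le (hN : 0 < N) (x : selfAdjoint (Mat N)) {g : ℝ → ℂ} {C : ℝ} (hC : 0 ≤ C)
    (hg : ∀ i, ‖g (eig x i)‖ ≤ C) : ‖fc x g‖ ≤ C := by
  have h1 : ‖Matrix.diagonal (fun i => g (eig x i))‖ ≤ C := by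
    rw [Matrix.l2_opNorm_diagonal]
    exact (pi_norm_le_iff_of_nonneg hC).2 hg
  have h2 := norm_eigU_le x hN
  have h3 := norm_star_eigU_le x hN
  rw [fc_apply]
  refine (norm_mul_le _ _).trans ?_
  refine (mul_le_mul (norm_mul_le _ _) h3 (norm_nonneg _) (by positivity)).trans ?_
  rw [mul_one]
  refine (mul_le_mul h2 h1 (norm_nonneg _) zero_le_one).trans_eq (one_mul C)

theorem abs_eig_le (hN : 0 < N) (x : selfAdjoint (Mat N)) (i : Fin N) : |eig x i| ≤ ‖x‖ := by
  have h : Matrix.diagonal (fun i => (eig x i : ℂ)) = star (eigU x) * (x : Mat N) * eigU x := by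
    conv_rhs => rw [← fc_ofReal x, fc_apply]
    simp only [mul_assoc]
    rw [star_eigU_mul, mul_one, ← mul_assoc, star_eigU_mul, one_mul]
  have h1 : ‖Matrix.diagonal (fun i => (eig x i : ℂ))‖ ≤ ‖x‖ := by
    rw [h]
    refine (norm_mul_le _ _).trans ?_
    refine (mul_le_mul (norm_mul_le _ _) (norm_eigU_le x hN) (norm_nonneg _)
      (by positivity)).trans ?_
    rw [mul_one]
    exact (mul_le_mul (norm_star_eigU_le x hN) le_rfl (norm_nonneg _) zero_le_one).trans_eq
      (one_mul _)
  rw [Matrix.l2_opNorm_diagonal] at h1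
  have h2 := (norm_le_pi_norm (fun i => (eig x i : ℂ)) i).trans h1
  simpa using h2

theorem hs_le_of_entries {A B : Mat N} {L : ℝ} (hL : 0 ≤ L) (h : ∀ a b, ‖A a b‖ ≤ L * ‖B a b‖) :
    hs A ≤ L * hs B := by
  refine le_of_sq_le_sq ?_ (mul_nonneg hL (hs_nonneg _))
  rw [mul_pow, hs_sq, hs_sq, mul_left_comm]
  refine mul_le_mul_of_nonneg_left ?_ (by positivity)
  simp only [Finset.mul_sum, ← mul_pow]
  exact Finset.sum_le_sum fun a _ => Finset.sum_le_sum fun b _ =>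
    pow_le_pow_left₀ (norm_nonneg _) (h b a) 2

theorem hs_conj_le {U V A : Mat N} (hU : ‖U‖ ≤ 1) (hV : ‖V‖ ≤ 1) : hs (U * A * V) ≤ hs A := by
  refine (hs_mul_le_right _ _).trans ?_
  refine (mul_le_mul (hs_mul_le_left _ _) hV (norm_nonneg _)
    (mul_nonneg (norm_nonneg _) (hs_nonneg _))).trans ?_
  rw [mul_one]
  exact mul_le_of_le_one_left (hs_nonneg _) hU

/-- A function that is `L`-Lipschitz on the spectra is operator Lipschitz in the `2`-norm with the
same constant. -/
theorem hs_fc_sub_fc_le (hN : 0 < N) (x y : selfAdjoint (Mat N)) {g : ℝ → ℂ} {L : ℝ} (hL : 0 ≤ L)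
    (hg : ∀ a b, ‖g (eig x a) - g (eig y b)‖ ≤ L * |eig x a - eig y b|) :
    hs (fc x g - fc y g) ≤ L * hs ((x : Mat N) - (y : Mat N)) := by
  -- With rows in the eigenbasis of `x` and columns in that of `y`, the difference acts by entrywise
  -- multiplication of one fixed matrix by `g(λ_a) - g(μ_b)`. Comparison with the identity function
  -- is then a comparison of entries.
  have key : ∀ g : ℝ → ℂ, star (eigU x) * (fc x g - fc y g) * eigU y =
      Matrix.of fun a b => (g (eig x a) - g (eig y b)) * (star (eigU x) * eigU y) a b := by
    intro g
    have : star (eigU x) * (fc x g - fc y g) * eigU y =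
        Matrix.diagonal (fun i => g (eig x i)) * (star (eigU x) * eigU y) -
          (star (eigU x) * eigU y) * Matrix.diagonal (fun i => g (eig y i)) := by
      rw [fc_apply, fc_apply, mul_sub, sub_mul]
      congr 1
      · simp only [← mul_assoc]
        rw [star_eigU_mul, one_mul]
      · simp only [mul_assoc]
        rw [star_eigU_mul, mul_one]
    rw [this]
    ext a b
    rw [Matrix.sub_apply, Matrix.diagonal_mul, Matrix.mul_diagonal, Matrix.of_apply]
    ring
  have h1 : hs (fc x g - fc y g) ≤ hs (star (eigU x) * (fc x g - fc y g) * eigU y) := by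
    have e : fc x g - fc y g =
        eigU x * (star (eigU x) * (fc x g - fc y g) * eigU y) * star (eigU y) := by
      simp only [← mul_assoc]
      rw [eigU_mul_star, one_mul, mul_assoc, eigU_mul_star, mul_one]
    conv_lhs => rw [e]
    exact hs_conj_le (norm_eigU_le x hN) (norm_star_eigU_le y hN)
  have h2 : hs (star (eigU x) * ((x : Mat N) - (y : Mat N)) * eigU y) ≤
      hs ((x : Mat N) - (y : Mat N)) :=
    hs_conj_le (norm_star_eigU_le x hN) (norm_eigU_le y hN)
  refine h1.trans (le_trans ?_ (mul_le_mul_of_nonneg_left h2 hL))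
  have h3 := key fun t => (t : ℂ)
  rw [fc_ofReal, fc_ofReal] at h3
  rw [key, h3]
  refine hs_le_of_entries hL fun a b => ?_
  rw [Matrix.of_apply, Matrix.of_apply, norm_mul, norm_mul, ← mul_assoc]
  refine mul_le_mul_of_nonneg_right ((hg a b).trans_eq ?_) (norm_nonneg _)
  rw [← Complex.ofReal_sub, Complex.norm_real, Real.norm_eq_abs]

end FunctionalCalculus

/-! ### Expansion of test functions in powers of the Cayley transform -/

section Cayley

/-- The Cayley transform `t ↦ (1 + i t) / (1 - i t)`, written as an exponential. -/
noncomputable def cay (t : ℝ) : ℂ := Complex.exp (2 * Real.arctan t * Complex.I)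

theorem norm_cay (t : ℝ) : ‖cay t‖ = 1 := by
  have : cay t = Complex.exp ((2 * Real.arctan t : ℝ) * Complex.I) := by
    rw [cay]
    push_cast
    rfl
  rw [this, Complex.norm_exp_ofReal_mul_I]

theorem one_sub_I_mul_ne_zero (t : ℝ) : (1 : ℂ) - t * Complex.I ≠ 0 := by
  intro h
  have := congrArg Complex.re h
  simp at this

/-- With `θ = arctan t`, multiplication by `cos θ` turns `1 ± i t` into `e^{± iθ}`. -/
theorem cay_mul (t : ℝ) : cay t * (1 - t * Complex.I) = 1 + t * Complex.I := by
  set θ := Real.arctan t with hθ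
  have hc : (Complex.cos θ) ≠ 0 := by
    rw [← Complex.ofReal_cos]
    exact_mod_cast (Real.cos_arctan_pos t).ne'
  have ht : (t : ℂ) * Complex.cos θ = Complex.sin θ := by
    rw [← Complex.tan_mul_cos hc, ← Complex.ofReal_tan, hθ, Real.tan_arctan]
  refine mul_right_cancel₀ hc ?_
  have h1 : (1 + t * Complex.I) * Complex.cos θ = Complex.exp (θ * Complex.I) := by
    rw [Complex.exp_mul_I, ← ht]
    ring
  have h2 : (1 - t * Complex.I) * Complex.cos θ = Complex.exp (-(θ * Complex.I)) := by
    rw [← neg_mul, Complex.exp_mul_I, Complex.cos_neg, Complex.sin_neg, ← ht]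
    ring
  rw [mul_assoc, h2, h1, cay, ← Complex.exp_add]
  congr 1
  ring

theorem cay_eq (t : ℝ) : cay t = 2 * (1 - t * Complex.I)⁻¹ - 1 := by
  have h := one_sub_I_mul_ne_zero t
  refine mul_right_cancel₀ h ?_
  rw [cay_mul, sub_mul, mul_assoc, inv_mul_cancel₀ h]
  ring

theorem cay_inv (t : ℝ) : (cay t)⁻¹ = cay (-t) := by
  rw [cay, cay, ← Complex.exp_neg, Real.arctan_neg]
  push_cast
  ring_nf

/-- Near a pole `|tan|` exceeds `r`, so the composition vanishes on a punctured neighbourhood. At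
the pole itself `Real.tan` has the default value 0, which is where `φ 0 = 0` enters. -/
theorem contDiff_comp_tan {φ : ℝ → ℝ} (hφ : ContDiff ℝ ∞ φ) {r : ℝ}
    (hφ_zero : ∀ t : ℝ, r ≤ |t| → φ t = 0) (h0 : φ 0 = 0) :
    ContDiff ℝ ∞ fun θ => (φ (Real.tan θ) : ℂ) := by
  rw [contDiff_iff_contDiffAt]
  intro θ
  by_cases hθ : Real.cos θ = 0
  · have h := (Real.tendsto_abs_tan_of_cos_eq_zero hθ).eventually_ge_atTop r
    rw [eventually_nhdsWithin_iff] at h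
    have h2 : (fun θ => (φ (Real.tan θ) : ℂ)) =ᶠ[𝓝 θ] fun _ => 0 := by
      filter_upwards [h] with x hx
      by_cases hxθ : x = θ
      · rw [hxθ, Real.tan_eq_sin_div_cos, hθ, div_zero, h0, Complex.ofReal_zero]
      · rw [hφ_zero _ (hx hxθ), Complex.ofReal_zero]
    exact contDiffAt_const.congr_of_eventuallyEq h2
  · exact Complex.ofRealCLM.contDiff.contDiffAt.comp θ
      (hφ.contDiffAt.comp θ (Real.contDiffAt_tan.2 hθ))

/-- Repeated integration by parts; periodicity removes the boundary terms. -/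
theorem fourierCoeffOn_decay {a b : ℝ} (hab : a < b) (k : ℕ) (g : ℝ → ℂ) (hg : ContDiff ℝ ∞ g)
    (hper : Function.Periodic g (b - a)) :
    ∃ C : ℝ, ∀ n : ℤ, ‖fourierCoeffOn hab g n‖ * |(n : ℝ)| ^ k ≤ C := by
  induction k generalizing g with
  | zero =>
    obtain ⟨C, hC⟩ := (isCompact_Icc (a := a) (b := b)).exists_bound_of_continuousOn
      hg.continuous.continuousOn
    refine ⟨1 / (b - a) * (C * |b - a|), fun n => ?_⟩
    have hpos : 0 < b - a := sub_pos.2 hab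
    rw [pow_zero, mul_one, fourierCoeffOn_eq_integral, norm_smul,
      Real.norm_of_nonneg (by positivity)]
    refine mul_le_mul_of_nonneg_left ?_ (by positivity)
    refine intervalIntegral.norm_integral_le_of_norm_le_const fun x hx => ?_
    rw [Set.uIoc_of_le hab.le] at hx
    rw [norm_smul, fourier_apply, Circle.norm_coe, one_mul]
    exact hC x ⟨hx.1.le, hx.2⟩
  | succ k ih =>
    have hd : ContDiff ℝ ∞ (deriv g) := (contDiff_infty_iff_deriv.1 hg).2
    have hdper : Function.Periodic (deriv g) (b - a) := by
      intro x
      have h : (fun y => g (y + (b - a))) = g := funext hper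
      rw [← deriv_comp_add_const, h]
    obtain ⟨C, hC⟩ := ih (deriv g) hd hdper
    refine ⟨(b - a) * C, fun n => ?_⟩
    have hpos : 0 < b - a := sub_pos.2 hab
    have hC0 : 0 ≤ C := le_trans (by positivity) (hC n)
    rcases eq_or_ne n 0 with rfl | hn
    · simp only [Int.cast_zero, abs_zero]
      rw [zero_pow (Nat.succ_ne_zero k), mul_zero]
      positivity
    have h1 := fourierCoeffOn_of_hasDerivAt hab (f := g) (f' := deriv g) hn
      (fun x _ => ((contDiff_infty_iff_deriv.1 hg).1 x).hasDerivAt)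
      (hd.continuous.intervalIntegrable _ _)
    have h2 : g b = g a := by
      have := hper a
      rwa [add_sub_cancel] at this
    have hn' : (0 : ℝ) < |(n : ℝ)| := by
      rw [abs_pos]
      exact_mod_cast hn
    rw [h2, sub_self, mul_zero, zero_sub, ← Complex.ofReal_sub, mul_neg, ← neg_mul] at h1
    have h3 : ‖fourierCoeffOn hab g n‖ =
        (b - a) * ‖fourierCoeffOn hab (deriv g) n‖ / (2 * Real.pi * |(n : ℝ)|) := by
      rw [h1]
      simp only [norm_mul, norm_neg, norm_div, norm_one, Complex.norm_real, Complex.norm_I,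
        Complex.norm_intCast, Real.norm_of_nonneg hpos.le, Real.norm_of_nonneg Real.pi_pos.le,
        Complex.norm_ofNat]
      field_simp
    rw [h3, pow_succ]
    have h4 : (b - a) * ‖fourierCoeffOn hab (deriv g) n‖ / (2 * Real.pi * |(n : ℝ)|) *
        (|(n : ℝ)| ^ k * |(n : ℝ)|) =
        (b - a) * (‖fourierCoeffOn hab (deriv g) n‖ * |(n : ℝ)| ^ k) / (2 * Real.pi) := by
      field_simp
    rw [h4]
    refine (div_le_self (by positivity) (by linarith [Real.pi_gt_three])).trans ?_
    exact mul_le_mul_of_nonneg_left (hC n) hpos.le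

/-- Under `θ = arctan t` the characters `e^{2inθ}` of period `π` become the powers `cay t ^ n`, so
this is the Fourier series of `φ ∘ tan`. The weight `4 (1 + n²)` dominates the three constants of
`jet_cay_zpow`. -/
theorem exists_cayley_expansion {φ : ℝ → ℝ} (hφ : ContDiff ℝ ∞ φ) {r : ℝ}
    (hφ_zero : ∀ t : ℝ, r ≤ |t| → φ t = 0) (h0 : φ 0 = 0) :
    ∃ c : ℤ → ℂ, (Summable fun n : ℤ => ‖c n‖ * (4 * (1 + (n : ℝ) ^ 2))) ∧
      ∀ t : ℝ, HasSum (fun n => c n * cay t ^ n) (φ t) := by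
  have hT : Fact (0 < Real.pi) := ⟨Real.pi_pos⟩
  set g : ℝ → ℂ := fun θ => (φ (Real.tan θ) : ℂ) with hg_def
  have hg : ContDiff ℝ ∞ g := contDiff_comp_tan hφ hφ_zero h0
  set a : ℝ := -(Real.pi / 2) with ha
  have hab : a < a + Real.pi := lt_add_of_pos_right a hT.out
  have hper' : Function.Periodic g Real.pi := fun x => by
    simp only [hg_def, Real.tan_periodic x]
  have hper : Function.Periodic g (a + Real.pi - a) := by
    rwa [add_sub_cancel_left]
  let G : C(AddCircle Real.pi, ℂ) := ⟨AddCircle.liftIco Real.pi a g,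
    AddCircle.liftIco_continuous (hper' a).symm hg.continuous.continuousOn⟩
  have hc : ∀ n, fourierCoeff G n = fourierCoeffOn hab g n := fun n => fourierCoeff_liftIco_eq g n
  -- Decay of order 2 pays for the constant part of the weight and decay of order 4 for the `n²`
  -- part; each leaves a summable `1 / n²`.
  obtain ⟨C₂, hC₂⟩ := fourierCoeffOn_decay hab 2 g hg hper
  obtain ⟨C₄, hC₄⟩ := fourierCoeffOn_decay hab 4 g hg hper
  simp only [← hc] at hC₂ hC₄
  have hsum : Summable fun n : ℤ => ‖fourierCoeff G n‖ * (4 * (1 + (n : ℝ) ^ 2)) := by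
    have h1 : Summable fun n : ℤ => (4 * (C₂ + C₄)) * (1 / (n : ℝ) ^ 2) :=
      (Real.summable_one_div_int_pow.2 one_lt_two).mul_left _
    refine Summable.of_norm_bounded_eventually h1 ?_
    filter_upwards [(Set.finite_singleton (0 : ℤ)).compl_mem_cofinite] with n hn
    have hn0 : (n : ℝ) ≠ 0 := by exact_mod_cast hn
    have hn2 : 0 < (n : ℝ) ^ 2 := by positivity
    have e2 := hC₂ n
    have e4 := hC₄ n
    rw [sq_abs] at e2
    rw [show |(n : ℝ)| ^ 4 = (n : ℝ) ^ 2 * (n : ℝ) ^ 2 by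
      rw [← sq_abs]
      ring] at e4
    rw [Real.norm_of_nonneg (by positivity), mul_one_div, le_div_iff₀ hn2]
    linarith
  refine ⟨fourierCoeff G, hsum, fun t => ?_⟩
  have hs' : Summable (fourierCoeff G) := by
    refine Summable.of_norm (hsum.of_nonneg_of_le (fun n => norm_nonneg _) fun n => ?_)
    exact le_mul_of_one_le_right (norm_nonneg _) (by nlinarith [sq_nonneg (n : ℝ)])
  have h := has_pointwise_sum_fourier_series_of_summable hs' (Real.arctan t : AddCircle Real.pi)
  have hG : G (Real.arctan t : AddCircle Real.pi) = (φ t : ℂ) := by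
    change AddCircle.liftIco Real.pi a g (Real.arctan t : AddCircle Real.pi) = _
    rw [AddCircle.liftIco_coe_apply ⟨(Real.neg_pi_div_two_lt_arctan t).le, by
      linarith [Real.arctan_lt_pi_div_two t]⟩, hg_def]
    simp only [Real.tan_arctan]
  rw [hG] at h
  refine h.congr_fun fun n => ?_
  rw [fourier_coe_apply, cay, ← Complex.exp_int_mul, smul_eq_mul]
  congr 2
  have : (Real.pi : ℂ) ≠ 0 := by exact_mod_cast Real.pi_ne_zero
  field_simp

end Cayley

/-! ### Second differences of functional calculus -/

section SecondDifference

variable {N : ℕ}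

/-- Write `w_i` for the resolvents, `h = X₁ - X₀` and `k = s i`. The resolvent identity applied
twice gives the second difference `2 k² w₁ h w₂ h w₀`, in which `h` occurs twice, each time between
contractions. Both signs of `s` are needed to reach negative powers of the Cayley transform. -/
theorem jet_resolvent (hN : 0 < N) {X : Fin 3 → selfAdjoint (Mat N)} {d : ℝ} (hd : 0 ≤ d)
    (hX : X 1 + X 2 = (2 : ℝ) • X 0) (hd1 : hs ((X 1 : Mat N) - (X 0 : Mat N)) ≤ d) {s : ℝ}
    (hs1 : |s| = 1) :
    Jet d 1 1 2 fun i => fc (X i) fun t => (1 - (s * t : ℝ) * Complex.I)⁻¹ := by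
  set w : Fin 3 → Mat N := fun i => fc (X i) fun t => (1 - (s * t : ℝ) * Complex.I)⁻¹ with hw
  set h : Mat N := (X 1 : Mat N) - (X 0 : Mat N) with hh
  set k : ℂ := s * Complex.I with hk
  have hk1 : ‖k‖ = 1 := by
    rw [hk, norm_mul, Complex.norm_I, Complex.norm_real, Real.norm_eq_abs, hs1, mul_one]
  have hX2 : (X 2 : Mat N) - (X 0 : Mat N) = -h := by
    have : (X 1 : Mat N) + (X 2 : Mat N) = (2 : ℝ) • (X 0 : Mat N) := by
      exact congrArg Subtype.val hX
    rw [two_smul] at this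
    rw [hh, eq_neg_iff_add_eq_zero]
    calc _ = ((X 1 : Mat N) + (X 2 : Mat N)) - ((X 0 : Mat N) + (X 0 : Mat N)) := by abel
      _ = 0 := by rw [this, sub_self]
  have hnorm : ∀ i, ‖w i‖ ≤ 1 := by
    intro i
    refine norm_fc_le hN _ zero_le_one fun a => ?_
    rw [norm_inv]
    refine inv_le_one_of_one_le₀ ?_
    have := Complex.abs_re_le_norm (1 - ((s * eig (X i) a : ℝ) : ℂ) * Complex.I)
    simpa using this
  have hinv : ∀ i, fc (X i) (fun t => 1 - (s * t : ℝ) * Complex.I) = 1 - k • (X i : Mat N) := by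
    intro i
    have : (fun t : ℝ => 1 - ((s * t : ℝ) : ℂ) * Complex.I) =
        (1 : ℝ → ℂ) - k • fun t : ℝ => (t : ℂ) := by
      funext t
      simp only [Pi.sub_apply, Pi.one_apply, Pi.smul_apply, smul_eq_mul, hk]
      push_cast
      ring
    rw [this, map_sub, map_one, map_smul, fc_ofReal]
  have hl : ∀ i, w i * (1 - k • (X i : Mat N)) = 1 := by
    intro i
    rw [← hinv, hw, ← map_mul, ← map_one (fc (X i))]
    congr 1
    funext t
    exact inv_mul_cancel₀ (one_sub_I_mul_ne_zero _)
  have hr : ∀ i, (1 - k • (X i : Mat N)) * w i = 1 := by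
    intro i
    rw [← hinv, hw, ← map_mul, ← map_one (fc (X i))]
    congr 1
    funext t
    exact mul_inv_cancel₀ (one_sub_I_mul_ne_zero _)
  have hdiff : ∀ i j, w i - w j = k • (w i * ((X i : Mat N) - (X j : Mat N)) * w j) := by
    intro i j
    have e : k • (w i * ((X i : Mat N) - (X j : Mat N)) * w j) =
        w i * ((1 - k • (X j : Mat N)) - (1 - k • (X i : Mat N))) * w j := by
      rw [sub_sub_sub_cancel_left, ← smul_sub, mul_smul_comm, smul_mul_assoc]
    rw [e, mul_sub, sub_mul, hl, one_mul, mul_assoc, hr, mul_one]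
  have hsw : ∀ i, hs ((X i : Mat N) - (X 0 : Mat N)) ≤ d := by
    intro i
    fin_cases i
    · simpa [hs_zero] using hd
    · exact hd1
    · change hs ((X 2 : Mat N) - (X 0 : Mat N)) ≤ d
      rw [hX2, hs_neg]
      exact hd1
  refine ⟨hnorm, fun i => ?_, fun B => ?_⟩
  · rw [hdiff, hs_smul, hk1, one_mul, one_mul]
    exact (hs_conj_le (hnorm i) (hnorm 0)).trans (hsw i)
  · have e1 : w 1 + w 2 - (2 : ℂ) • w 0 = k • ((w 1 - w 2) * h * w 0) := by
      have : w 1 + w 2 - (2 : ℂ) • w 0 = (w 1 - w 0) + (w 2 - w 0) := by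
        rw [two_smul]
        abel
      rw [this, hdiff, hdiff, hX2, ← hh, ← smul_add]
      congr 1
      noncomm_ring
    have e2 : (X 1 : Mat N) - (X 2 : Mat N) = (2 : ℂ) • h := by
      have : (X 1 : Mat N) - (X 2 : Mat N) =
          ((X 1 : Mat N) - (X 0 : Mat N)) - ((X 2 : Mat N) - (X 0 : Mat N)) := by abel
      rw [this, hX2, ← hh, sub_neg_eq_add, two_smul]
    have e3 : B * (w 1 + w 2 - (2 : ℂ) • w 0) = (k * k * 2) • ((B * w 1 * h) * (w 2 * h * w 0)) := by
      rw [e1, hdiff, e2]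
      simp only [mul_smul_comm, smul_mul_assoc, smul_smul, mul_assoc]
    have b1 : hs (B * w 1 * h) ≤ ‖B‖ * d := by
      refine (hs_mul_le_left _ _).trans (mul_le_mul ?_ hd1 (hs_nonneg _) (norm_nonneg _))
      exact (norm_mul_le _ _).trans (mul_le_of_le_one_right (norm_nonneg _) (hnorm 1))
    have b2 : hs (w 2 * h * w 0) ≤ d := (hs_conj_le (hnorm 2) (hnorm 0)).trans hd1
    rw [e3, map_smul, norm_smul, norm_mul, norm_mul, hk1, Complex.norm_ofNat]
    have b3 := (norm_ntr_mul_le _ _).trans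
      (mul_le_mul b1 b2 (hs_nonneg _) (mul_nonneg (norm_nonneg _) hd))
    linarith

theorem jet_cay (hN : 0 < N) {X : Fin 3 → selfAdjoint (Mat N)} {d : ℝ} (hd : 0 ≤ d)
    (hX : X 1 + X 2 = (2 : ℝ) • X 0) (hd1 : hs ((X 1 : Mat N) - (X 0 : Mat N)) ≤ d) {s : ℝ}
    (hs1 : |s| = 1) :
    Jet d 1 2 4 fun i => fc (X i) fun t => cay (s * t) := by
  have h1 := ((jet_resolvent hN hd hX hd1 hs1).smul 2).add ((Jet.one hN (d := d)).smul (-1))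
  have e : (fun i => fc (X i) fun t => cay (s * t)) =
      ((2 : ℂ) • fun i => fc (X i) fun t => (1 - (s * t : ℝ) * Complex.I)⁻¹) +
        (-1 : ℂ) • (1 : Fin 3 → Mat N) := by
    funext i
    rw [Pi.add_apply, Pi.smul_apply, Pi.smul_apply, Pi.one_apply, ← map_smul,
      ← map_one (fc (X i)), ← map_smul, ← map_add]
    congr 1
    funext t
    simp only [Pi.add_apply, Pi.smul_apply, smul_eq_mul, Pi.one_apply]
    rw [cay_eq]
    ring
  rw [← e] at h1
  -- The sum in `h1` only gives the norm bound 3. The sharp bound 1, from `|cay t| = 1`, keeps the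
  -- constants of powers polynomial.
  refine ⟨fun i => norm_fc_le hN _ zero_le_one fun a => (norm_cay _).le, fun i => ?_, fun B => ?_⟩
  · refine (h1.2 i).trans (le_of_eq ?_)
    norm_num
  · refine (h1.3 B).trans (le_of_eq ?_)
    norm_num

/-- The recursion of `Jet.mul` closes exactly: `4n² + 4 + 2 · 2n · 2 = 4(n+1)²`. -/
theorem Jet.pow (hN : 0 < N) {d : ℝ} (hd : 0 ≤ d) {A : Fin 3 → Mat N} (hA : Jet d 1 2 4 A) (n : ℕ) :
    Jet d 1 (2 * n) (4 * n ^ 2) (A ^ n) := by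
  induction n with
  | zero => simpa using Jet.one hN (d := d)
  | succ n ih =>
    rw [pow_succ]
    refine (Jet.mul hd (by positivity) (by positivity) (by positivity) ih hA).mono hd ?_ ?_ ?_
    · norm_num
    · push_cast
      linarith
    · push_cast
      linarith

theorem jet_cay_zpow (hN : 0 < N) {X : Fin 3 → selfAdjoint (Mat N)} {d : ℝ} (hd : 0 ≤ d)
    (hX : X 1 + X 2 = (2 : ℝ) • X 0) (hd1 : hs ((X 1 : Mat N) - (X 0 : Mat N)) ≤ d) (n : ℤ) :
    Jet d 1 (2 * |(n : ℝ)|) (4 * (n : ℝ) ^ 2) fun i => fc (X i) fun t => cay t ^ n := by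
  obtain ⟨k, rfl | rfl⟩ := n.eq_nat_or_neg
  · have h := (jet_cay hN hd hX hd1 (s := 1) (by simp)).pow hN hd k
    have e : (fun i => fc (X i) fun t => cay t ^ (k : ℤ)) =
        (fun i => fc (X i) fun t => cay (1 * t)) ^ k := by
      funext i
      rw [Pi.pow_apply, ← map_pow]
      congr 1
      funext t
      simp
    rw [e]
    simpa using h
  · have h := (jet_cay hN hd hX hd1 (s := -1) (by simp)).pow hN hd k
    have e : (fun i => fc (X i) fun t => cay t ^ (-(k : ℤ))) =
        (fun i => fc (X i) fun t => cay (-1 * t)) ^ k := by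
      funext i
      rw [Pi.pow_apply, ← map_pow]
      congr 1
      funext t
      rw [Pi.pow_apply, neg_one_mul, ← cay_inv, zpow_neg, zpow_natCast, inv_pow]
    rw [e]
    simpa using h

theorem Jet.sum {α : Type*} (hN : 0 < N) {d : ℝ} (s : Finset α) {A : α → Fin 3 → Mat N} {K : α → ℝ}
    (hA : ∀ n, Jet d (K n) (K n) (K n) (A n)) :
    Jet d (∑ n ∈ s, K n) (∑ n ∈ s, K n) (∑ n ∈ s, K n) (∑ n ∈ s, A n) := by
  classical
  induction s using Finset.induction_on with
  | empty => simpa using (Jet.one hN (d := d)).smul 0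
  | insert n s hn ih =>
    rw [Finset.sum_insert hn, Finset.sum_insert hn]
    exact (hA n).add ih

theorem continuous_hs : Continuous (hs : Mat N → ℝ) := by
  have : (hs : Mat N → ℝ) = fun A => Real.sqrt ((N : ℝ)⁻¹ * ∑ a, ∑ b, ‖A b a‖ ^ 2) := by
    funext A
    rw [← hs_sq, Real.sqrt_sq (hs_nonneg _)]
  rw [this]
  fun_prop

/-- Each defining inequality is closed, so it passes from the finite partial sums to the limit. -/
theorem Jet.hasSum {α : Type*} (hN : 0 < N) {d : ℝ} (hd : 0 ≤ d) {A : α → Fin 3 → Mat N} {K : α → ℝ}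
    {B : Fin 3 → Mat N} (hK : Summable K) (hA : ∀ n, Jet d (K n) (K n) (K n) (A n))
    (hB : ∀ i, HasSum (fun n => A n i) (B i)) : Jet d (∑' n, K n) (∑' n, K n) (∑' n, K n) B := by
  have h0 : ∀ n, 0 ≤ K n := fun n => (norm_nonneg _).trans ((hA n).1 0)
  have hle : ∀ s : Finset α, ∑ n ∈ s, K n ≤ ∑' n, K n := fun s => hK.sum_le_tsum s fun n _ => h0 n
  have hjet := fun s : Finset α => (Jet.sum hN s hA).mono hd (hle s) (hle s) (hle s)
  have hlim : ∀ i, Tendsto (fun s : Finset α => (∑ n ∈ s, A n) i) atTop (𝓝 (B i)) := by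
    intro i
    simpa [HasSum] using hB i
  refine ⟨fun i => ?_, fun i => ?_, fun M => ?_⟩
  · exact le_of_tendsto (hlim i).norm (Eventually.of_forall fun s => (hjet s).1 i)
  · exact le_of_tendsto ((continuous_hs.tendsto _).comp ((hlim i).sub (hlim 0)))
      (Eventually.of_forall fun s => (hjet s).2 i)
  · have hc : Continuous fun Y : Mat N => ‖ntr N (M * Y)‖ :=
      ((ntrL N).continuous.comp (continuous_const.mul continuous_id)).norm
    exact le_of_tendsto ((hc.tendsto _).comp
      (((hlim 1).add (hlim 2)).sub ((hlim 0).const_smul (2 : ℂ))))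
      (Eventually.of_forall fun s => (hjet s).3 M)

theorem continuous_fc (x : selfAdjoint (Mat N)) : Continuous (fc x) := by
  have h : Continuous fun g : ℝ → ℂ =>
      eigU x * Matrix.diagonal (fun i => g (eig x i)) * star (eigU x) := by
    have : Continuous fun g : ℝ → ℂ => Matrix.diagonal (fun i => g (eig x i)) :=
      Continuous.matrix_diagonal (continuous_pi fun i => continuous_apply _)
    exact (continuous_const.mul this).mul continuous_const
  exact h

/-- Smooth compactly supported functions have operator second differences of order two in the dual
of the operator norm, uniformly in the size of the matrices. -/
theorem exists_jet_cfc {φ : ℝ → ℝ} (hφ : ContDiff ℝ ∞ φ) {r : ℝ}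
    (hφ_zero : ∀ t : ℝ, r ≤ |t| → φ t = 0) (h0 : φ 0 = 0) :
    ∃ K : ℝ, ∀ N : ℕ, 0 < N → ∀ d : ℝ, 0 ≤ d → ∀ X : Fin 3 → selfAdjoint (Mat N),
      X 1 + X 2 = (2 : ℝ) • X 0 → hs ((X 1 : Mat N) - (X 0 : Mat N)) ≤ d →
      Jet d K K K fun i => cfc φ (X i : Mat N) := by
  obtain ⟨c, hc, hsum⟩ := exists_cayley_expansion hφ hφ_zero h0
  refine ⟨_, fun N hN d hd X hX hd1 => Jet.hasSum hN hd hc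
    (A := fun n => c n • fun i => fc (X i) fun t => cay t ^ n) (fun n => ?_) fun i => ?_⟩
  · refine ((jet_cay_zpow hN hd hX hd1 n).smul (c n)).mono hd ?_ ?_ ?_ <;>
      refine mul_le_mul_of_nonneg_left ?_ (norm_nonneg _)
    · nlinarith [sq_nonneg (n : ℝ)]
    · nlinarith [sq_nonneg (|(n : ℝ)| - 1), sq_abs (n : ℝ)]
    · linarith
  · have h1 : HasSum (fun n : ℤ => fun t : ℝ => c n * cay t ^ n) fun t => (φ t : ℂ) :=
      Pi.hasSum.2 hsum
    rw [cfc_eq_fc]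
    refine (h1.map (fc (X i)) (continuous_fc (X i))).congr_fun fun n => ?_
    rw [Function.comp_apply, Pi.smul_apply, ← map_smul]
    rfl

end SecondDifference

/-! ### Polynomial approximation in `C¹` -/

section Approximation

theorem exists_derivative_eq (p : Polynomial ℝ) : ∃ q : Polynomial ℝ, q.derivative = p := by
  induction p using Polynomial.induction_on' with
  | add p q hp hq =>
    obtain ⟨p', rfl⟩ := hp
    obtain ⟨q', rfl⟩ := hq
    exact ⟨p' + q', Polynomial.derivative_add⟩
  | monomial n a =>
    refine ⟨Polynomial.monomial (n + 1) (a / (n + 1)), ?_⟩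
    rw [Polynomial.derivative_monomial, Nat.add_sub_cancel]
    congr 1
    push_cast
    field_simp

/-- A continuously differentiable function is a limit of polynomials, locally uniformly and in the
local Lipschitz seminorms. -/
theorem exists_polynomial_approx {φ : ℝ → ℝ} (hφ : ContDiff ℝ 1 φ) (h0 : φ 0 = 0) :
    ∃ q : ℕ → Polynomial ℝ, ∀ r η : ℝ, 0 < η → ∃ K : ℕ, ∀ k ≥ K, ∀ s t : ℝ, |s| ≤ r → |t| ≤ r →
      |(q k).eval t - φ t| ≤ η ∧
      |((q k).eval s - φ s) - ((q k).eval t - φ t)| ≤ η * |s - t| := by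
  -- The polynomial is a primitive of a Weierstrass approximation of `φ'`. Since it agrees with `φ`
  -- at 0, the error `1/(k+1)²` in the derivative costs at most `1/(k+1)` in the values on an
  -- interval of radius `k + 1`.
  have key : ∀ k : ℕ, ∃ q : Polynomial ℝ, q.eval 0 = 0 ∧ ∀ s t : ℝ, |s| ≤ k + 1 → |t| ≤ k + 1 →
      |(q.eval s - φ s) - (q.eval t - φ t)| ≤ (1 / ((k : ℝ) + 1) ^ 2) * |s - t| := by
    intro k
    obtain ⟨p, hp⟩ := exists_polynomial_near_of_continuousOn (-((k : ℝ) + 1)) (k + 1) (deriv φ)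
      (hφ.continuous_deriv le_rfl).continuousOn (1 / ((k : ℝ) + 1) ^ 2) (by positivity)
    obtain ⟨q, rfl⟩ := exists_derivative_eq p
    refine ⟨q - Polynomial.C (q.eval 0), by simp, fun s t hs ht => ?_⟩
    have hd : ∀ x, HasDerivAt (fun x => (q - Polynomial.C (q.eval 0)).eval x - φ x)
        (q.derivative.eval x - deriv φ x) x := by
      intro x
      have h1 := (q - Polynomial.C (q.eval 0)).hasDerivAt x
      rw [Polynomial.derivative_sub, Polynomial.derivative_C, sub_zero] at h1
      exact h1.sub ((hφ.differentiable one_ne_zero) x).hasDerivAt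
    have h := (convex_Icc (-((k : ℝ) + 1)) (k + 1)).norm_image_sub_le_of_norm_hasDerivWithin_le
      (f := fun x => (q - Polynomial.C (q.eval 0)).eval x - φ x)
      (fun x _ => (hd x).hasDerivWithinAt) (fun x hx => (hp x hx).le) (abs_le.1 ht) (abs_le.1 hs)
    simpa only [Real.norm_eq_abs] using h
  choose q hq0 hq using key
  refine ⟨q, fun r η hη => ?_⟩
  obtain ⟨K₁, hK₁⟩ := exists_nat_ge r
  obtain ⟨K₂, hK₂⟩ := exists_nat_ge (1 / η)
  refine ⟨max K₁ K₂, fun k hk s t hs ht => ?_⟩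
  have hk1 : (K₁ : ℝ) ≤ k := by exact_mod_cast (le_max_left _ _).trans hk
  have hk2 : (K₂ : ℝ) ≤ k := by exact_mod_cast (le_max_right _ _).trans hk
  have hkpos : (0 : ℝ) < (k : ℝ) + 1 := by positivity
  have hs' : |s| ≤ (k : ℝ) + 1 := by linarith
  have ht' : |t| ≤ (k : ℝ) + 1 := by linarith
  have hη1 : 1 / ((k : ℝ) + 1) ≤ η := by
    rw [div_le_comm₀ hkpos hη]
    linarith
  have hη2 : 1 / ((k : ℝ) + 1) ^ 2 ≤ 1 / ((k : ℝ) + 1) := by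
    refine one_div_le_one_div_of_le hkpos ?_
    nlinarith
  constructor
  · have h := hq k t 0 ht' (by rw [abs_zero]; exact hkpos.le)
    rw [hq0, h0, sub_zero, sub_zero, sub_zero] at h
    refine h.trans ((mul_le_mul_of_nonneg_left ht' (by positivity)).trans ?_)
    refine le_trans (le_of_eq ?_) hη1
    field_simp
  · exact (hq k s t hs' ht').trans
      (mul_le_mul_of_nonneg_right (hη2.trans hη1) (abs_nonneg _))

end Approximation

/-! ### Substitution of polynomials into trace polynomials -/

section Substitution

variable {m N : ℕ}

/-- The substitution `X_j ↦ q(X_j)` on non-commutative polynomials. -/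
noncomputable def substNCP (q : Polynomial ℝ) : NCP m →ₐ[ℂ] NCP m :=
  FreeAlgebra.lift ℂ fun j =>
    Polynomial.aeval (FreeAlgebra.ι ℂ j) (q.map (algebraMap ℝ ℂ))

theorem tr_mul_comm (p q : NCP m) : tr (p * q) = tr (q * p) := by
  rw [tr, LinearMap.comp_apply, LinearMap.comp_apply]
  congr 1
  rw [← sub_eq_zero, ← map_sub, Submodule.mkQ_apply, Submodule.Quotient.mk_eq_zero]
  exact Submodule.subset_span ⟨(p, q), rfl⟩

/-- The substitution `X_j ↦ q(X_j)` on trace polynomials. -/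
noncomputable def subst (q : Polynomial ℝ) : TrP0 m →ₐ[ℂ] TrP0 m :=
  SymmetricAlgebra.lift (descend (tr ∘ₗ (substNCP q).toLinearMap) fun a b => by
    simp [tr_mul_comm (substNCP q a)])

theorem subst_tr (q : Polynomial ℝ) (p : NCP m) : subst q (tr p) = tr (substNCP q p) := by
  simp [subst, tr, descend]

theorem cfc_polynomial_eq (x : selfAdjoint (Mat N)) (q : Polynomial ℝ) :
    cfc (fun t => q.eval t) (x : Mat N) =
      Polynomial.aeval (x : Mat N) (q.map (algebraMap ℝ ℂ)) := by
  rw [cfc_eq_fc, ← fc_aeval]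
  congr 1
  funext t
  rw [Polynomial.eval_map_algebraMap]
  exact (Polynomial.aeval_algebraMap_apply ℂ t q).symm

theorem evalNCP_substNCP (x : Tup m N) (q : Polynomial ℝ) (p : NCP m) :
    evalNCP x (substNCP q p) = evalNCP (cutoff (fun t => q.eval t) x) p := by
  have : (evalNCP x).comp (substNCP q) = evalNCP (cutoff (fun t => q.eval t) x) := by
    refine FreeAlgebra.hom_ext (funext fun j => ?_)
    simp only [Function.comp_apply, AlgHom.comp_apply, substNCP, evalNCP, FreeAlgebra.lift_ι_apply,
      cutoff]
    rw [cfc_polynomial_eq, ← Polynomial.aeval_algHom_apply, FreeAlgebra.lift_ι_apply]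
  exact DFunLike.congr_fun this p

theorem eval0_subst (x : Tup m N) (q : Polynomial ℝ) (f : TrP0 m) :
    eval0 x (subst q f) = eval0 (cutoff (fun t => q.eval t) x) f := by
  induction f using TrP0.induction with
  | scalar c => simp
  | tr p => rw [subst_tr, eval0_tr, eval0_tr, evalNCP_substNCP]
  | mul f g hf hg => rw [map_mul, map_mul, map_mul, hf, hg]
  | add f g hf hg => rw [map_add, map_add, map_add, hf, hg]

end Substitution

/-! ### Uniform bounds for trace polynomials and their gradients -/

section Bounds

variable {m N : ℕ}

/-- `f` and `Df` are bounded by `e` on the operator norm ball of radius `r`, in every dimension. -/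
def BoundedBy (r e : ℝ) (f : TrP0 m) : Prop :=
  ∀ N : ℕ, 0 < N → ∀ x : Tup m N, ‖x‖ ≤ r → ‖eval0 x f‖ ≤ e ∧ norm2 (evalGrad x f) ≤ e

theorem BoundedBy.mono {r e e' : ℝ} {f : TrP0 m} (h : BoundedBy r e f) (he : e ≤ e') :
    BoundedBy r e' f := fun N hN x hx => ⟨(h N hN x hx).1.trans he, (h N hN x hx).2.trans he⟩

theorem BoundedBy.smul {r e : ℝ} {f : TrP0 m} (c : ℂ) (h : BoundedBy r e f) :
    BoundedBy r (‖c‖ * e) (c • f) := by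
  intro N hN x hx
  rw [map_smul, map_smul, norm2_smul, norm_smul]
  exact ⟨mul_le_mul_of_nonneg_left (h N hN x hx).1 (norm_nonneg _),
    mul_le_mul_of_nonneg_left (h N hN x hx).2 (norm_nonneg _)⟩

/-- Bounds for a trace polynomial on a larger ball, together with Lipschitz bounds in the
`2`-norm, bound the gradient. -/
theorem boundedBy_of_lipschitz {r e : ℝ} {f : TrP0 m} (h : ∀ N : ℕ, 0 < N → ∀ x y : Tup m N,
    ‖x‖ ≤ r + 1 → ‖y‖ ≤ r + 1 → ‖eval0 x f‖ ≤ e ∧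
      ‖eval0 y f - eval0 x f‖ ≤ e * norm2 fun j => (y j : Mat N) - (x j : Mat N)) :
    BoundedBy r (2 * e) f := by
  intro N hN x hx
  have hx' : ‖x‖ ≤ r + 1 := by linarith
  have h1 := (h N hN x x hx' hx').1
  have he : 0 ≤ e := (norm_nonneg _).trans h1
  refine ⟨by linarith, norm2_le_of_hasFDerivAt (hasFDerivAt_eval0 f x) he ?_⟩
  -- The extra unit of radius leaves room for a full neighbourhood of `x`, even when `‖x‖ = r`.
  have hball : ∀ᶠ y in 𝓝 x, ‖y‖ ≤ r + 1 := by
    have hc : Tendsto (fun y : Tup m N => ‖y‖) (𝓝 x) (𝓝 ‖x‖) := continuous_norm.tendsto x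
    exact (hc.eventually (gt_mem_nhds (by linarith : ‖x‖ < r + 1))).mono fun y hy => hy.le
  filter_upwards [hball] with y hy using (h N hN x y hx' hy).2

theorem norm_coe_le {x : Tup m N} {r : ℝ} (hx : ‖x‖ ≤ r) (j : Fin m) : ‖(x j : Mat N)‖ ≤ r :=
  (norm_le_pi_norm x j).trans hx

theorem exists_boundedBy (f : TrP0 m) (r : ℝ) : ∃ e : ℝ, BoundedBy r e f := by
  obtain ⟨K', hK'⟩ := TraceStable.exists_bound_eval0 (ι := Fin 4) f (max (r + 1) 1)
  refine ⟨2 * K', boundedBy_of_lipschitz fun N hN x y hx hy => ?_⟩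
  set d := norm2 fun j => (y j : Mat N) - (x j : Mat N) with hd
  have hK0 : 0 ≤ max (r + 1) 1 := zero_le_one.trans (le_max_right _ _)
  -- With `η = 0` and repeated tuples, `Close` reduces to boundedness and a 2-norm Lipschitz bound.
  have h := hK' N hN (Close 0 d) (Close.traceStable hN le_rfl (norm2_nonneg _)) ![x, y, x, y]
    fun j => by
      have hj : hs ((y j : Mat N) - (x j : Mat N)) ≤ max (r + 1) 1 * d :=
        (hs_le_norm2 (fun j => (y j : Mat N) - (x j : Mat N)) j).trans
          (le_mul_of_one_le_left (norm2_nonneg _) (le_max_right _ _))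
      refine ⟨fun i => ?_, ?_, ?_, hj, hj, ?_⟩
      · fin_cases i
        exacts [(norm_coe_le hx j).trans (le_max_left _ _),
          (norm_coe_le hy j).trans (le_max_left _ _), (norm_coe_le hx j).trans (le_max_left _ _),
          (norm_coe_le hy j).trans (le_max_left _ _)]
      all_goals simp [hs_zero]
  have h1 := h.1 0
  have h2 := h.4
  simp only [Matrix.cons_val_zero, Matrix.cons_val_one] at h1 h2
  rw [norm_smul, norm_one_mat hN, mul_one] at h1
  rw [← sub_smul, hs_smul, hs_one hN, mul_one] at h2
  exact ⟨h1, h2⟩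

theorem abs_eig_le_of_norm_le (hN : 0 < N) {x : Tup m N} {r : ℝ} (hx : ‖x‖ ≤ r) (j : Fin m)
    (i : Fin N) : |eig (x j) i| ≤ r :=
  (abs_eig_le hN (x j) i).trans ((norm_le_pi_norm x j).trans hx)

/-- The functional calculi of two functions that are close in the Lipschitz sense. -/
theorem close_cutoff (hN : 0 < N) {p q : ℝ → ℝ} {r η K : ℝ} (hη : 0 ≤ η) (hK : 1 ≤ K)
    (hp : ∀ t, |t| ≤ r → |p t| ≤ K) (hq : ∀ t, |t| ≤ r → |q t| ≤ K)
    (hp' : ∀ s t, |s| ≤ r → |t| ≤ r → |p s - p t| ≤ K * |s - t|)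
    (hq' : ∀ s t, |s| ≤ r → |t| ≤ r → |q s - q t| ≤ K * |s - t|)
    (hpq : ∀ t, |t| ≤ r → |p t - q t| ≤ η)
    (hpq' : ∀ s t, |s| ≤ r → |t| ≤ r → |(p s - q s) - (p t - q t)| ≤ η * |s - t|)
    {x y : Tup m N} (hx : ‖x‖ ≤ r) (hy : ‖y‖ ≤ r) (j : Fin m) :
    Close η (norm2 fun j => (y j : Mat N) - (x j : Mat N)) K
      ![(cutoff p x j : Mat N), cutoff p y j, cutoff q x j, cutoff q y j] := by
  set d := norm2 fun j => (y j : Mat N) - (x j : Mat N) with hd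
  have hK0 : 0 ≤ K := zero_le_one.trans hK
  have hj : hs ((y j : Mat N) - (x j : Mat N)) ≤ d :=
    hs_le_norm2 (fun j => (y j : Mat N) - (x j : Mat N)) j
  have ex := abs_eig_le_of_norm_le hN hx j
  have ey := abs_eig_le_of_norm_le hN hy j
  have sub_eq : ∀ z : Tup m N, (cutoff p z j : Mat N) - cutoff q z j =
      fc (z j) fun t => ((p t - q t : ℝ) : ℂ) := by
    intro z
    simp only [cutoff, cfc_eq_fc, ← map_sub]
    congr 1
    funext t
    simp
  have lip : ∀ (g : ℝ → ℝ) (L : ℝ), 0 ≤ L →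
      (∀ s t, |s| ≤ r → |t| ≤ r → |g s - g t| ≤ L * |s - t|) →
      hs (fc (y j) (fun t => (g t : ℂ)) - fc (x j) fun t => (g t : ℂ)) ≤ L * d := by
    intro g L hL hg
    refine (hs_fc_sub_fc_le hN _ _ hL fun a b => ?_).trans (mul_le_mul_of_nonneg_left hj hL)
    rw [← Complex.ofReal_sub, Complex.norm_real]
    exact hg _ _ (ey a) (ex b)
  have bdd : ∀ (z : Tup m N) (_ : ‖z‖ ≤ r) (g : ℝ → ℝ) (L : ℝ), 0 ≤ L →
      (∀ t, |t| ≤ r → |g t| ≤ L) → ‖fc (z j) fun t => (g t : ℂ)‖ ≤ L := by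
    intro z hz g L hL hg
    refine norm_fc_le hN _ hL fun a => ?_
    rw [Complex.norm_real]
    exact hg _ (abs_eig_le_of_norm_le hN hz j a)
  have hηK : η ≤ η * K := le_mul_of_one_le_right hη hK
  have hd0 : 0 ≤ d := norm2_nonneg _
  constructor
  · intro i
    fin_cases i <;> simp [cutoff, cfc_eq_fc]
    exacts [bdd x hx p K hK0 hp, bdd y hy p K hK0 hp, bdd x hx q K hK0 hq, bdd y hy q K hK0 hq]
  · simp only [Matrix.cons_val]
    rw [sub_eq]
    exact (bdd x hx _ η hη hpq).trans hηK
  · simp only [Matrix.cons_val]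
    rw [sub_eq]
    exact (bdd y hy _ η hη hpq).trans hηK
  · simp only [Matrix.cons_val, cutoff, cfc_eq_fc]
    exact lip p K hK0 hp'
  · simp only [Matrix.cons_val, cutoff, cfc_eq_fc]
    exact lip q K hK0 hq'
  · simp only [Matrix.cons_val]
    rw [sub_eq, sub_eq]
    exact (lip (fun t => p t - q t) η hη hpq').trans (mul_le_mul_of_nonneg_right hηK hd0)

/-- The substitutions of polynomials converging to `φ` form a Cauchy sequence. -/
theorem cauchy_subst {φ : ℝ → ℝ} (hφ : ContDiff ℝ 1 φ) {q : ℕ → Polynomial ℝ}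
    (hq : ∀ r η : ℝ, 0 < η → ∃ K : ℕ, ∀ k ≥ K, ∀ s t : ℝ, |s| ≤ r → |t| ≤ r →
      |(q k).eval t - φ t| ≤ η ∧
      |((q k).eval s - φ s) - ((q k).eval t - φ t)| ≤ η * |s - t|)
    (f : TrP0 m) (r e : ℝ) (he : 0 < e) :
    ∃ K : ℕ, ∀ k ≥ K, ∀ l ≥ K, BoundedBy r e (subst (q k) f - subst (q l) f) := by
  obtain ⟨B, hB⟩ := (isCompact_Icc (a := -(r + 1)) (b := r + 1)).exists_bound_of_continuousOn
    hφ.continuous.continuousOn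
  obtain ⟨D, hD⟩ := (isCompact_Icc (a := -(r + 1)) (b := r + 1)).exists_bound_of_continuousOn
    (hφ.continuous_deriv le_rfl).continuousOn
  have hlip : ∀ s t, |s| ≤ r + 1 → |t| ≤ r + 1 → |φ s - φ t| ≤ D * |s - t| := by
    intro s t hs ht
    exact (convex_Icc (-(r + 1)) (r + 1)).norm_image_sub_le_of_norm_deriv_le
      (fun x _ => (hφ.differentiable one_ne_zero) x) (fun x hx => hD x hx) (abs_le.1 ht)
      (abs_le.1 hs)
  set M := |B| + |D| + 1 with hM
  obtain ⟨K', hK'⟩ := TraceStable.exists_bound_eval0 (ι := Fin 4) f M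
  -- The final bound is `4 η K'`: one factor 2 because `q_k` and `q_l` are both `η`-close to `φ`,
  -- another from `boundedBy_of_lipschitz`. The cap keeps `η ≤ 1`, so the summand 1 in `M` covers
  -- the approximation error.
  set η : ℝ := min (1 / 2) (e / (4 * (|K'| + 1))) with hη_def
  have hη : 0 < η := by positivity
  have hη1 : η ≤ 1 := (min_le_left _ _).trans (by norm_num)
  obtain ⟨K, hK⟩ := hq (r + 1) η hη
  refine ⟨K, fun k hk l hl => ?_⟩
  have bound : ∀ k ≥ K, ∀ t, |t| ≤ r + 1 → |(q k).eval t| ≤ M := by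
    intro k hk t ht
    have h1 := (hK k hk t t ht ht).1
    have h2 := hB t (abs_le.1 ht)
    rw [Real.norm_eq_abs] at h2
    have h3 := abs_sub_abs_le_abs_sub ((q k).eval t) (φ t)
    have h4 := le_abs_self B
    have h5 := abs_nonneg D
    rw [hM]
    linarith
  have lip : ∀ k ≥ K, ∀ s t, |s| ≤ r + 1 → |t| ≤ r + 1 →
      |(q k).eval s - (q k).eval t| ≤ M * |s - t| := by
    intro k hk s t hs ht
    have h1 := (hK k hk s t hs ht).2
    have h2 := hlip s t hs ht
    have h3 : (q k).eval s - (q k).eval t =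
        (((q k).eval s - φ s) - ((q k).eval t - φ t)) + (φ s - φ t) := by ring
    rw [h3]
    refine (abs_add_le _ _).trans ((add_le_add h1 h2).trans ?_)
    rw [← add_mul]
    refine mul_le_mul_of_nonneg_right ?_ (abs_nonneg _)
    have h4 := le_abs_self D
    have h5 := abs_nonneg B
    rw [hM]
    linarith
  have hclose : BoundedBy r (2 * (2 * η * K')) (subst (q k) f - subst (q l) f) := by
    refine boundedBy_of_lipschitz fun N hN x y hx hy => ?_
    set d := norm2 fun j => (y j : Mat N) - (x j : Mat N) with hd
    have h := hK' N hN (Close (2 * η) d)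
      (Close.traceStable hN (by positivity) (norm2_nonneg _))
      ![cutoff (fun t => (q k).eval t) x, cutoff (fun t => (q k).eval t) y,
        cutoff (fun t => (q l).eval t) x, cutoff (fun t => (q l).eval t) y] fun j => by
      have := close_cutoff hN (p := fun t => (q k).eval t) (q := fun t => (q l).eval t)
        (η := 2 * η) (K := M) (r := r + 1) (by positivity)
        (by
          rw [hM]
          linarith [abs_nonneg B, abs_nonneg D])
        (bound k hk) (bound l hl) (lip k hk) (lip l hl)
        (fun t ht => by
          have h1 := (hK k hk t t ht ht).1
          have h2 := (hK l hl t t ht ht).1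
          rw [abs_le] at h1 h2 ⊢
          constructor <;> linarith)
        (fun s t hs ht => by
          have h1 := (hK k hk s t hs ht).2
          have h2 := (hK l hl s t hs ht).2
          rw [abs_le] at h1 h2 ⊢
          constructor <;> linarith) hx hy j
      convert! this using 1
      funext i
      fin_cases i <;> rfl
    -- The second field of `Close` is the difference of values at `x`; the sixth is the increment of
    -- that difference from `x` to `y`, that is, its Lipschitz bound.
    have h2 := h.2
    have h6 := h.6
    simp only [Matrix.cons_val, ← sub_smul, norm_smul, norm_one_mat hN, hs_smul, hs_one hN,
      mul_one] at h2 h6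
    simp only [map_sub, eval0_subst]
    exact ⟨h2, h6⟩
  refine hclose.mono ?_
  have h1 : η * (4 * (|K'| + 1)) ≤ e := by
    rw [← le_div_iff₀ (by positivity)]
    exact min_le_right _ _
  have h2 : η * K' ≤ η * (|K'| + 1) :=
    mul_le_mul_of_nonneg_left ((le_abs_self _).trans (by linarith)) hη.le
  linarith

end Bounds

/-! ### Limits in the completion -/

section Completion

variable {m N : ℕ}

/-- Dominated convergence for the counting measure: the seminorms are capped at 1, so twice a
geometric series dominates. -/
theorem tendsto_size {α : Type*} {l : Filter α} [l.IsCountablyGenerated] {g : α → TrP0 m}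
    (h0 : ∀ n : ℕ, Tendsto (fun a => seminorm0 ((n : ℝ) + 1) (g a)) l (𝓝 0))
    (h1 : ∀ n : ℕ, Tendsto (fun a => seminorm1 ((n : ℝ) + 1) (g a)) l (𝓝 0)) :
    Tendsto (fun a => size (g a)) l (𝓝 0) := by
  have e : ∀ a, size (g a) = ∫⁻ n : ℕ, (2⁻¹ : ℝ≥0∞) ^ (n + 1) *
      (min 1 (seminorm0 ((n : ℝ) + 1) (g a)) + min 1 (seminorm1 ((n : ℝ) + 1) (g a)))
      ∂MeasureTheory.Measure.count := by
    intro a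
    rw [MeasureTheory.lintegral_count]
    rfl
  simp only [e]
  have z : (0 : ℝ≥0∞) = ∫⁻ _ : ℕ, 0 ∂MeasureTheory.Measure.count := by simp
  rw [z]
  refine MeasureTheory.tendsto_lintegral_filter_of_dominated_convergence
    (fun n => (2⁻¹ : ℝ≥0∞) ^ (n + 1) * 2) ?_ ?_ ?_ ?_
  · exact Eventually.of_forall fun _ => measurable_of_countable _
  · refine Eventually.of_forall fun a => Eventually.of_forall fun n => ?_
    refine mul_le_mul' le_rfl ?_
    rw [← one_add_one_eq_two]
    exact add_le_add (min_le_left _ _) (min_le_left _ _)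
  · rw [MeasureTheory.lintegral_count, ENNReal.tsum_mul_right, ENNReal.tsum_geometric_add_one]
    refine ENNReal.mul_ne_top (ENNReal.mul_ne_top (by simp) ?_) (by simp)
    simp [ENNReal.one_sub_inv_two]
  · refine Eventually.of_forall fun n => ?_
    have h := ((tendsto_const_nhds (x := (1 : ℝ≥0∞))).min (h0 n)).add
      ((tendsto_const_nhds (x := (1 : ℝ≥0∞))).min (h1 n))
    simp only [zero_le, inf_of_le_right, add_zero] at h
    have h2 := ENNReal.Tendsto.const_mul (a := (2⁻¹ : ℝ≥0∞) ^ (n + 1)) h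
      (Or.inr (ENNReal.pow_ne_top (by simp)))
    rwa [mul_zero] at h2

theorem BoundedBy.seminorm0_le {r e : ℝ} {f : TrP0 m} (h : BoundedBy r e f) :
    seminorm0 r f ≤ ENNReal.ofReal e := by
  refine iSup₂_le fun N hN => iSup₂_le fun x hx => ?_
  rw [← ofReal_norm]
  exact ENNReal.ofReal_le_ofReal (h N hN x hx).1

theorem BoundedBy.seminorm1_le {r e : ℝ} {f : TrP0 m} (h : BoundedBy r e f) :
    seminorm1 r f ≤ ENNReal.ofReal e :=
  iSup₂_le fun N hN => iSup₂_le fun x hx => ENNReal.ofReal_le_ofReal (h N hN x hx).2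

theorem exists_ofReal_le {ε : ℝ≥0∞} (hε : 0 < ε) : ∃ e : ℝ, 0 < e ∧ ENNReal.ofReal e ≤ ε := by
  obtain ⟨e, he0, he⟩ := ENNReal.lt_iff_exists_nnreal_btwn.1 hε
  exact ⟨e, by exact_mod_cast he0, by
    rw [ENNReal.ofReal_coe_nnreal]
    exact he.le⟩

theorem continuous_norm2 : Continuous (norm2 : (Fin m → Mat N) → ℝ) := by
  have : (norm2 : (Fin m → Mat N) → ℝ) = fun y => Real.sqrt (∑ j, hs (y j) ^ 2) := by
    funext y
    rw [← norm2_sq, Real.sqrt_sq (norm2_nonneg _)]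
  rw [this]
  exact Real.continuous_sqrt.comp (continuous_finsetSum _ fun j _ =>
    (continuous_hs.comp (continuous_apply j)).pow 2)

/-- A Cauchy sequence of trace polynomials has a limit in `T_m^{0,1}`, whose values and gradients
are locally uniform limits. -/
theorem exists_limit {g : ℕ → TrP0 m}
    (hg : ∀ r e : ℝ, 0 < e → ∃ K : ℕ, ∀ k ≥ K, ∀ l ≥ K, BoundedBy r e (g k - g l)) :
    ∃ V : T01 m, ∀ r e : ℝ, 0 < e → ∃ K : ℕ, ∀ k ≥ K, ∀ N : ℕ, 0 < N → ∀ x : Tup m N, ‖x‖ ≤ r →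
      ‖eval0 x (g k) - V.val x‖ ≤ e ∧ norm2 (evalGrad x (g k) - V.gradVal x) ≤ e := by
  have hcauchy : CauchySeq g := by
    have small : ∀ r : ℝ, ∀ ε : ℝ≥0∞, 0 < ε → ∀ᶠ p : ℕ × ℕ in atTop,
        seminorm0 r (g p.1 - g p.2) ≤ ε ∧ seminorm1 r (g p.1 - g p.2) ≤ ε := by
      intro r ε hε
      obtain ⟨e, he, hle⟩ := exists_ofReal_le hε
      obtain ⟨K, hK⟩ := hg r e he
      filter_upwards [eventually_ge_atTop (K, K)] with p hp
      have h := hK p.1 hp.1 p.2 hp.2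
      exact ⟨h.seminorm0_le.trans hle, h.seminorm1_le.trans hle⟩
    have hsize := tendsto_size (l := atTop) (g := fun p : ℕ × ℕ => g p.1 - g p.2)
      (fun n => ENNReal.tendsto_nhds_zero.2 fun ε hε => (small _ ε hε).mono fun _ h => h.1)
      (fun n => ENNReal.tendsto_nhds_zero.2 fun ε hε => (small _ ε hε).mono fun _ h => h.2)
    refine EMetric.cauchySeq_iff.2 fun ε hε => ?_
    obtain ⟨a, ha⟩ := eventually_atTop.1 (hsize.eventually (gt_mem_nhds hε))
    refine ⟨max a.1 a.2, fun k hk l hl => ?_⟩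
    exact ha (k, l) ⟨(le_max_left _ _).trans hk, (le_max_right _ _).trans hl⟩
  obtain ⟨V, hV⟩ := cauchySeq_tendsto_of_complete
    (UniformSpace.Completion.uniformContinuous_coe (TrP0 m) |>.comp_cauchySeq hcauchy)
  refine ⟨V, fun r e he => ?_⟩
  obtain ⟨K, hK⟩ := hg r e he
  refine ⟨K, fun k hk N hN x hx => ?_⟩
  have h0 : Tendsto (fun l => eval0 x (g l)) atTop (𝓝 (T01.val V x)) := by
    have hc : Continuous fun W : T01 m => W.val x := UniformSpace.Completion.continuous_extension
    refine ((hc.tendsto V).comp hV).congr fun l => ?_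
    exact T01.val_coe hN x (g l)
  have h1 : Tendsto (fun l => evalGrad x (g l)) atTop (𝓝 (T01.gradVal V x)) := by
    have hc : Continuous fun W : T01 m => W.gradVal x := UniformSpace.Completion.continuous_extension
    refine ((hc.tendsto V).comp hV).congr fun l => ?_
    exact T01.gradVal_coe hN x (g l)
  constructor
  -- Let `l → ∞` in the Cauchy estimate with `k` fixed; the threshold `K` does not depend on `N` or
  -- `x`.
  · refine le_of_tendsto (tendsto_const_nhds.sub h0).norm ?_
    filter_upwards [eventually_ge_atTop K] with l hl
    rw [← map_sub]
    exact (hK k hk l hl N hN x hx).1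
  · refine le_of_tendsto ((continuous_norm2.tendsto _).comp (tendsto_const_nhds.sub h1)) ?_
    filter_upwards [eventually_ge_atTop K] with l hl
    rw [Function.comp_apply, ← map_sub]
    exact (hK k hk l hl N hN x hx).2

end Completion

/-! ### Midpoint convexity -/

section Convexity

/-- A positive maximum on the interval would be attained at a leftmost point, which is interior. The
midpoint inequality there forces the same value further to the left. -/
theorem nonpos_of_midpoint {g : ℝ → ℝ} (hc : Continuous g) (h0 : g 0 = 0) (h1 : g 1 = 0)
    (hg : ∀ t s, 2 * g t ≤ g (t + s) + g (t - s)) {t : ℝ} (ht : t ∈ Set.Icc (0 : ℝ) 1) :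
    g t ≤ 0 := by
  by_contra! hpos
  obtain ⟨u, hu, hmax⟩ := isCompact_Icc.exists_isMaxOn ⟨t, ht⟩ hc.continuousOn
  have hM : 0 < g u := hpos.trans_le (hmax ht)
  have hcomp : IsCompact (Set.Icc (0 : ℝ) 1 ∩ g ⁻¹' {g u}) :=
    isCompact_Icc.inter_right (isClosed_singleton.preimage hc)
  obtain ⟨v, ⟨hv, hgv⟩, hmin⟩ := hcomp.exists_isLeast ⟨u, hu, rfl⟩
  have hgv : g v = g u := hgv
  have hv0 : 0 < v := lt_of_le_of_ne hv.1 fun h => by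
    rw [← h, h0] at hgv
    exact hM.ne hgv
  have hv1 : v < 1 := lt_of_le_of_ne hv.2 fun h => by
    rw [h, h1] at hgv
    exact hM.ne hgv
  set s := min v (1 - v) with hs
  have hs0 : 0 < s := lt_min hv0 (sub_pos.2 hv1)
  have hs1 : s ≤ v := min_le_left _ _
  have hs2 : s ≤ 1 - v := min_le_right _ _
  have hl : v - s ∈ Set.Icc (0 : ℝ) 1 := ⟨by linarith, by linarith⟩
  have hr : v + s ∈ Set.Icc (0 : ℝ) 1 := ⟨by linarith, by linarith⟩
  have hl' : g (v - s) ≤ g u := hmax hl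
  have hr' : g (v + s) ≤ g u := hmax hr
  have h2 := hg v s
  have h3 : g (v - s) = g u := by linarith
  have h4 := hmin ⟨hl, h3⟩
  linarith

/-- A continuous midpoint convex function is convex. -/
theorem convexOn_of_midpoint {E : Type*} [NormedAddCommGroup E] [NormedSpace ℝ E] {G : E → ℝ}
    (hc : Continuous G) (hG : ∀ x k, 2 * G x ≤ G (x + k) + G (x - k)) :
    ConvexOn ℝ Set.univ G := by
  refine ⟨convex_univ, fun x _ y _ a b ha hb hab => ?_⟩
  -- Subtracting the chord preserves the midpoint inequality and makes both endpoint values zero.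
  set g : ℝ → ℝ := fun t => G (x + t • (y - x)) - (G x + t * (G y - G x)) with hg
  have hgc : Continuous g := by
    have : Continuous fun t : ℝ => G (x + t • (y - x)) := hc.comp (by fun_prop)
    fun_prop
  have h := nonpos_of_midpoint hgc (by simp [hg]) (by simp [hg]) (fun t s => by
    have h2 := hG (x + t • (y - x)) (s • (y - x))
    have e1 : x + t • (y - x) + s • (y - x) = x + (t + s) • (y - x) := by
      rw [add_smul, add_assoc]
    have e2 : x + t • (y - x) - s • (y - x) = x + (t - s) • (y - x) := by
      rw [sub_smul, add_sub_assoc]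
    rw [e1, e2] at h2
    simp only [hg]
    linarith) (t := b) ⟨hb, by linarith⟩
  have e : a • x + b • y = x + b • (y - x) := by
    rw [← eq_sub_iff_add_eq] at hab
    rw [hab, sub_smul, one_smul, smul_sub]
    abel
  rw [e, smul_eq_mul, smul_eq_mul]
  simp only [hg] at h
  rw [← eq_sub_iff_add_eq] at hab
  rw [hab]
  linarith

end Convexity

/-! ### Differentiability of limits, and second differences of the cut-off trace polynomials -/

section Potential

variable {m N : ℕ}

theorem norm_pairing_le (g : Fin m → Mat N) : ‖pairing g‖ ≤ m * norm2 g := by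
  refine ContinuousLinearMap.opNorm_le_bound _ (mul_nonneg (by positivity) (norm2_nonneg _))
    fun h => ?_
  rcases Nat.eq_zero_or_pos N with rfl | hN
  · have : pairing g h = 0 := by
      rw [pairing_apply]
      refine Finset.sum_eq_zero fun j _ => ?_
      simp [ntr_apply]
    rw [this, norm_zero]
    exact mul_nonneg (mul_nonneg (by positivity) (norm2_nonneg _)) (norm_nonneg _)
  rw [pairing_apply, mul_assoc]
  have hj : ∀ j ∈ Finset.univ, ‖ntr N (g j * (h j : Mat N))‖ ≤ norm2 g * ‖h‖ := fun j _ =>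
    (norm_ntr_mul_le _ _).trans (mul_le_mul (hs_le_norm2 g j)
      ((hs_le_norm hN _).trans (norm_le_pi_norm h j)) (hs_nonneg _) (norm2_nonneg _))
  refine (norm_sum_le_of_le _ hj).trans (le_of_eq ?_)
  rw [Finset.sum_const, Finset.card_univ, Fintype.card_fin, nsmul_eq_mul]

/-- `V` is the limit of the trace polynomials `g k`, locally uniformly with gradients. -/
def IsLimit (g : ℕ → TrP0 m) (V : T01 m) : Prop :=
  ∀ r e : ℝ, 0 < e → ∃ K : ℕ, ∀ k ≥ K, ∀ N : ℕ, 0 < N → ∀ x : Tup m N, ‖x‖ ≤ r →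
    ‖eval0 x (g k) - T01.val V x‖ ≤ e ∧ norm2 (evalGrad x (g k) - T01.gradVal V x) ≤ e

theorem IsLimit.tendsto {g : ℕ → TrP0 m} {V : T01 m} (h : IsLimit g V) (hN : 0 < N)
    (x : Tup m N) : Tendsto (fun k => eval0 x (g k)) atTop (𝓝 (T01.val V x)) := by
  refine Metric.tendsto_atTop.2 fun e he => ?_
  obtain ⟨K, hK⟩ := h ‖x‖ (e / 2) (by positivity)
  refine ⟨K, fun k hk => ?_⟩
  rw [dist_eq_norm]
  exact (hK k hk N hN x le_rfl).1.trans_lt (by linarith)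

theorem hasFDerivAt_of_uniform_ball {E : Type*} [NormedAddCommGroup E] [NormedSpace ℝ E]
    {f : ℕ → E → ℂ} {f' : ℕ → E → E →L[ℝ] ℂ} {g : E → ℂ} {g' : E → E →L[ℝ] ℂ} {x : E}
    (hu : ∀ e : ℝ, 0 < e → ∀ᶠ k in atTop, ∀ y ∈ Metric.ball x 1, ‖f' k y - g' y‖ < e)
    (hf : ∀ k, ∀ y ∈ Metric.ball x 1, HasFDerivAt (f k) (f' k y) y)
    (hg : ∀ y ∈ Metric.ball x 1, Tendsto (fun k => f k y) atTop (𝓝 (g y))) :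
    HasFDerivAt g (g' x) x := by
  refine hasFDerivAt_of_tendstoUniformlyOn Metric.isOpen_ball
    (Metric.tendstoUniformlyOn_iff.2 fun e he => ?_) hf hg (Metric.mem_ball_self one_pos)
  filter_upwards [hu e he] with k hk y hy
  rw [dist_comm, dist_eq_norm]
  exact hk y hy

/-- For fixed `N` the gradients converge uniformly on the unit ball about `x`, and `norm_pairing_le`
turns this into uniform convergence of the derivatives. -/
theorem IsLimit.hasFDerivAt {g : ℕ → TrP0 m} {V : T01 m} (h : IsLimit g V) (hN : 0 < N)
    (x : Tup m N) :
    HasFDerivAt (fun x : Tup m N => T01.val V x) (pairing (T01.gradVal V x)) x := by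
  refine hasFDerivAt_of_uniform_ball (E := Tup m N) (x := x) (g := fun y => T01.val V y)
    (g' := fun y => pairing (T01.gradVal V y)) (fun e he => ?_)
    (fun k y _ => hasFDerivAt_eval0 (g k) y) (fun y _ => h.tendsto hN y)
  obtain ⟨K, hK⟩ := h (‖x‖ + 1) (e / (m + 1)) (by positivity)
  filter_upwards [eventually_ge_atTop K] with k hk y hy
  have hy' : ‖y‖ ≤ ‖x‖ + 1 := by
    have h1 := norm_sub_norm_le y x
    have hy := mem_ball_iff_norm.1 hy
    linarith
  rw [← pairing_sub]
  refine (norm_pairing_le _).trans_lt ?_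
  have h2 := mul_le_mul_of_nonneg_left (hK k hk N hN y hy').2 (Nat.cast_nonneg (α := ℝ) m)
  refine h2.trans_lt ?_
  rw [mul_div_assoc', div_lt_iff₀ (by positivity)]
  linarith

theorem IsLimit.exists_bound {g : ℕ → TrP0 m} {V : T01 m} (h : IsLimit g V) (r : ℝ) :
    ∃ e : ℝ, ∀ N : ℕ, 0 < N → ∀ x : Tup m N, ‖x‖ ≤ r →
      ‖T01.val V x‖ ≤ e ∧ norm2 (T01.gradVal V x) ≤ e := by
  obtain ⟨K, hK⟩ := h r 1 one_pos
  obtain ⟨e, he⟩ := exists_boundedBy (g K) r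
  refine ⟨e + 1, fun N hN x hx => ?_⟩
  have h1 := hK K le_rfl N hN x hx
  have h2 := he N hN x hx
  constructor
  · have h3 := norm_sub_norm_le (T01.val V x) (eval0 x (g K))
    rw [norm_sub_rev] at h3
    linarith
  · have e1 : T01.gradVal V x = evalGrad x (g K) + -(evalGrad x (g K) - T01.gradVal V x) := by
      abel
    have h3 := norm2_add_le (evalGrad x (g K)) (-(evalGrad x (g K) - T01.gradVal V x))
    rw [← e1, norm2_neg] at h3
    linarith

/-- As `φ N` equals `V` for every `N ≥ 1`, its gradient is `DV` itself, and only the uniform bounds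
require an argument. -/
theorem IsLimit.isClassOf {g : ℕ → TrP0 m} {V : T01 m} (h : IsLimit g V)
    {φ : ∀ N : ℕ, Tup m N → ℂ} (hφ : ∀ N, 0 < N → ∀ x : Tup m N, φ N x = T01.val V x) :
    IsClassOf φ V := by
  refine ⟨fun r => ?_, fun r => ?_, fun N x => T01.gradVal V x, fun N hN x => ?_, fun r => ?_,
    fun r => ?_⟩
  · obtain ⟨e, he⟩ := h.exists_bound r
    refine (limsup_le_of_le (a := ENNReal.ofReal e) (by isBoundedDefault) ?_).trans_lt
      ENNReal.ofReal_lt_top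
    filter_upwards [eventually_gt_atTop 0] with N hN
    refine iSup₂_le fun x hx => ?_
    rw [hφ N hN, ← ofReal_norm]
    exact ENNReal.ofReal_le_ofReal (he N hN x hx).1
  · refine le_antisymm (limsup_le_of_le (by isBoundedDefault) ?_) zero_le
    filter_upwards [eventually_gt_atTop 0] with N hN
    refine iSup₂_le fun x hx => ?_
    rw [hφ N hN, sub_self, enorm_zero]
  · rw [hasNormalizedGradientAt_iff, show φ N = fun x => T01.val V x from funext (hφ N hN)]
    exact h.hasFDerivAt hN x
  · obtain ⟨e, he⟩ := h.exists_bound r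
    refine (limsup_le_of_le (a := ENNReal.ofReal e) (by isBoundedDefault) ?_).trans_lt
      ENNReal.ofReal_lt_top
    filter_upwards [eventually_gt_atTop 0] with N hN
    exact iSup₂_le fun x hx => ENNReal.ofReal_le_ofReal (he N hN x hx).2
  · refine le_antisymm (limsup_le_of_le (by isBoundedDefault) ?_) zero_le
    refine Eventually.of_forall fun N => iSup₂_le fun x hx => ?_
    change ENNReal.ofReal (norm2 (T01.gradVal V x - T01.gradVal V x)) ≤ 0
    rw [sub_self, norm2_zero, ENNReal.ofReal_zero]

theorem sqNorm2_eq (x : Tup m N) : sqNorm2 x = (N : ℝ)⁻¹ *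
    ‖WithLp.toLp 2 (fun i : Fin m × Fin N × Fin N => (x i.1 : Mat N) i.2.1 i.2.2)‖ ^ 2 := by
  rw [sqNorm2, norm2_eq, mul_pow, Real.sq_sqrt (by positivity)]

theorem sqNorm2_parallelogram (x k : Tup m N) :
    sqNorm2 (x + k) + sqNorm2 (x - k) = 2 * (sqNorm2 x + sqNorm2 k) := by
  set a := WithLp.toLp 2 (fun i : Fin m × Fin N × Fin N => (x i.1 : Mat N) i.2.1 i.2.2)
    with ha
  set b := WithLp.toLp 2 (fun i : Fin m × Fin N × Fin N => (k i.1 : Mat N) i.2.1 i.2.2)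
    with hb
  have h := parallelogram_law_with_norm ℂ a b
  have h1 : sqNorm2 (x + k) = (N : ℝ)⁻¹ * ‖a + b‖ ^ 2 := sqNorm2_eq _
  have h2 : sqNorm2 (x - k) = (N : ℝ)⁻¹ * ‖a - b‖ ^ 2 := sqNorm2_eq _
  rw [h1, h2, sqNorm2_eq, sqNorm2_eq, ← ha, ← hb, ← mul_add, ← mul_add, mul_left_comm]
  congr 1

theorem continuous_sqNorm2 : Continuous (sqNorm2 : Tup m N → ℝ) := by
  have h : Continuous fun x : Tup m N => fun j => (x j : Mat N) :=
    continuous_pi fun j => continuous_subtype_val.comp (continuous_apply j)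
  exact (continuous_norm2.comp h).pow 2

/-- The trace polynomial `½ ∑_j τ(X_j²)`. -/
noncomputable def halfSq (m : ℕ) : TrP0 m :=
  (1 / 2 : ℂ) • ∑ j, tr (FreeAlgebra.ι ℂ j * FreeAlgebra.ι ℂ j)

theorem eval0_halfSq (x : Tup m N) : eval0 x (halfSq m) = ((1 / 2 * sqNorm2 x : ℝ) : ℂ) := by
  have h : ∀ j, ntr N ((x j : Mat N) * x j) = ((hs (x j : Mat N) ^ 2 : ℝ) : ℂ) := by
    intro j
    rw [← ntr_conjTranspose_mul_self_eq_hs, (isHermitian_coe (x j)).eq]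
  rw [halfSq, map_smul, map_sum, sqNorm2, norm2_sq]
  simp only [eval0_tr, map_mul, evalNCP, FreeAlgebra.lift_ι_apply, h]
  push_cast
  rfl

theorem norm_cutoff_sub_le (hN : 0 < N) (x : Tup m N) {p q : ℝ → ℝ} {η : ℝ} (hη : 0 ≤ η)
    (h : ∀ t, |t| ≤ ‖x‖ → |p t - q t| ≤ η) : ‖cutoff p x - cutoff q x‖ ≤ η := by
  refine (pi_norm_le_iff_of_nonneg hη).2 fun j => ?_
  change ‖cfc p (x j : Mat N) - cfc q (x j : Mat N)‖ ≤ η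
  rw [cfc_eq_fc, cfc_eq_fc, ← map_sub]
  refine norm_fc_le hN _ hη fun i => ?_
  rw [Pi.sub_apply, ← Complex.ofReal_sub, Complex.norm_real]
  exact h _ (abs_eig_le_of_norm_le hN le_rfl j i)

/-- The second differences of `x ↦ f(Φ_N(x))` are bounded by the squared `2`-norm. -/
theorem exists_second_difference_bound (f : TrP0 m) {φ : ℝ → ℝ} (hφ : ContDiff ℝ ∞ φ) {r : ℝ}
    (hφ_zero : ∀ t : ℝ, r ≤ |t| → φ t = 0) (h0 : φ 0 = 0) :
    ∃ C : ℝ, ∀ N : ℕ, 0 < N → ∀ x k : Tup m N,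
      ‖eval0 (cutoff φ (x + k)) f + eval0 (cutoff φ (x - k)) f - 2 * eval0 (cutoff φ x) f‖ ≤
        C * sqNorm2 k := by
  obtain ⟨K, hK⟩ := exists_jet_cfc hφ hφ_zero h0
  obtain ⟨C, hC⟩ := TraceStable.exists_bound_eval0 (ι := Fin 3) f K
  refine ⟨C, fun N hN x k => ?_⟩
  set d := norm2 fun j => (k j : Mat N) with hd
  have hd0 : 0 ≤ d := norm2_nonneg _
  have h := hC N hN (fun K => Jet d K K K) (Jet.traceStable hN hd0)
    ![cutoff φ x, cutoff φ (x + k), cutoff φ (x - k)] fun j => by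
      have hj := hK N hN d hd0 ![x j, (x + k) j, (x - k) j]
        (by
          simp only [Matrix.cons_val, Pi.add_apply, Pi.sub_apply]
          rw [two_smul]
          abel)
        (by
          have : ((x + k) j : Mat N) - (x j : Mat N) = k j := by
            rw [Pi.add_apply, AddSubgroup.coe_add, add_sub_cancel_left]
          simp only [Matrix.cons_val]
          rw [this]
          exact hs_le_norm2 (fun j => (k j : Mat N)) j)
      convert! hj using 1
      funext i
      fin_cases i <;> rfl
  -- The values are scalars times the identity, so the test matrix `1` recovers their second
  -- difference.
  have h3 := h.3 1
  simp only [Matrix.cons_val] at h3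
  rwa [smul_smul, ← add_smul, ← sub_smul, one_mul, map_smul, ntr_one hN, smul_eq_mul, mul_one,
    norm_one_mat hN, mul_one] at h3

end Potential

/-! ### The potentials as elements of `T_m^{0,1}` -/

section Final

variable {m N : ℕ}

theorem potential_re (f : TrP0 m) (φ : ℝ → ℝ) (ε : ℝ) (x : Tup m N) :
    (potential f φ ε N x).re = 1 / 2 * sqNorm2 x + ε * (eval0 (cutoff φ x) f).re := by
  rw [potential, Complex.add_re, Complex.ofReal_re, Complex.re_ofReal_mul]

theorem potential_im (f : TrP0 m) (φ : ℝ → ℝ) (ε : ℝ) (x : Tup m N) :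
    (potential f φ ε N x).im = ε * (eval0 (cutoff φ x) f).im := by
  rw [potential, Complex.add_im, Complex.ofReal_im, Complex.im_ofReal_mul, zero_add]

theorem exists_isLimit_potential (f : TrP0 m) {φ : ℝ → ℝ} (hφ : ContDiff ℝ 1 φ) (h0 : φ 0 = 0)
    (ε : ℝ) : ∃ (g : ℕ → TrP0 m) (V : T01 m), IsLimit g V ∧
      ∀ N, 0 < N → ∀ x : Tup m N, potential f φ ε N x = T01.val V x := by
  obtain ⟨q, hq⟩ := exists_polynomial_approx hφ h0
  set g : ℕ → TrP0 m := fun k => halfSq m + (ε : ℂ) • subst (q k) f with hg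
  have hcauchy : ∀ r e : ℝ, 0 < e → ∃ K : ℕ, ∀ k ≥ K, ∀ l ≥ K, BoundedBy r e (g k - g l) := by
    intro r e he
    obtain ⟨K, hK⟩ := cauchy_subst hφ hq f r (e / (|ε| + 1)) (by positivity)
    refine ⟨K, fun k hk l hl => ?_⟩
    have e1 : g k - g l = (ε : ℂ) • (subst (q k) f - subst (q l) f) := by
      rw [hg, smul_sub]
      exact add_sub_add_left_eq_sub _ _ _
    rw [e1]
    refine ((hK k hk l hl).smul (ε : ℂ)).mono ?_
    rw [Complex.norm_real, Real.norm_eq_abs, mul_div_assoc', div_le_iff₀ (by positivity)]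
    nlinarith [abs_nonneg ε]
  obtain ⟨V, hV⟩ := exists_limit hcauchy
  have hV : IsLimit g V := hV
  refine ⟨g, V, hV, fun N hN x => ?_⟩
  refine tendsto_nhds_unique ?_ (hV.tendsto hN x)
  -- The limit is identified pointwise: at a fixed `x`, norm convergence of the functional calculi
  -- and continuity of the evaluation of `f` suffice.
  have hcut : Tendsto (fun k => cutoff (fun t => (q k).eval t) x) atTop (𝓝 (cutoff φ x)) := by
    refine tendsto_iff_norm_sub_tendsto_zero.2 (Metric.tendsto_atTop.2 fun e he => ?_)
    obtain ⟨K, hK⟩ := hq ‖x‖ (e / 2) (by positivity)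
    refine ⟨K, fun k hk => ?_⟩
    rw [dist_zero_right, norm_norm]
    exact (norm_cutoff_sub_le hN x (by positivity) fun t ht => (hK k hk t t ht ht).1).trans_lt
      (by linarith)
  have hcont : Continuous fun y : Tup m N => eval0 y f :=
    continuous_iff_continuousAt.2 fun y =>
      HasFDerivAt.continuousAt (𝕜 := ℝ) (E := Tup m N) (F := ℂ) (hasFDerivAt_eval0 f y)
  have h := (((hcont.tendsto _).comp hcut).const_mul (ε : ℂ)).const_add
    ((1 / 2 * sqNorm2 x : ℝ) : ℂ)
  refine h.congr fun k => ?_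
  simp only [hg, map_add, map_smul, eval0_halfSq, eval0_subst, smul_eq_mul, Function.comp_apply]

/-- By the parallelogram law the quadratic term has second difference exactly `2 a ‖k‖_2²`, which
absorbs that of `ε F`. -/
theorem convexOn_sqNorm2_add {F : Tup m N → ℝ} (hF : Continuous F) {C a ε : ℝ}
    (hC : ∀ x k, |F (x + k) + F (x - k) - 2 * F x| ≤ C * sqNorm2 k) (hε : |ε| * C ≤ 2 * a) :
    ConvexOn ℝ Set.univ fun x => a * sqNorm2 x + ε * F x := by
  refine convexOn_of_midpoint
    ((continuous_const.mul continuous_sqNorm2).add (continuous_const.mul hF)) fun x k => ?_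
  change 2 * (a * sqNorm2 x + ε * F x) ≤
    (a * sqNorm2 (x + k) + ε * F (x + k)) + (a * sqNorm2 (x - k) + ε * F (x - k))
  have h1 := sqNorm2_parallelogram x k
  have h2 : |ε * (F (x + k) + F (x - k) - 2 * F x)| ≤ 2 * a * sqNorm2 k := by
    rw [abs_mul]
    refine (mul_le_mul_of_nonneg_left (hC x k) (abs_nonneg _)).trans ?_
    rw [← mul_assoc]
    exact mul_le_mul_of_nonneg_right hε (sq_nonneg _)
  have h3 := (abs_le.1 h2).1
  have h4 : a * (sqNorm2 (x + k) + sqNorm2 (x - k)) = a * (2 * (sqNorm2 x + sqNorm2 k)) := by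
    rw [h1]
  linarith

end Final

end TracePoly

theorem mainTheorem10 (m : ℕ) (f : TracePoly.TrP0 m) (R : ℝ) (hR : 0 < R) (φ : ℝ → ℝ)
    (hφ : ContDiff ℝ ∞ φ) (hφ_id : ∀ t : ℝ, |t| ≤ R → φ t = t)
    (hφ_zero : ∀ t : ℝ, 2 * R ≤ |t| → φ t = 0) :
    ∃ V : ℝ → TracePoly.T01 m,
      (∀ ε : ℝ, TracePoly.IsClassOf (TracePoly.potential f φ ε) (V ε)) ∧
      ((∀ N : ℕ, 0 < N → ∀ x : TracePoly.Tup m N, (TracePoly.eval0 x f).im = 0) →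
        ∀ δ : ℝ, 0 < δ → ∃ ε₀ : ℝ, 0 < ε₀ ∧ ∀ ε : ℝ, |ε| < ε₀ →
          V ε ∈ TracePoly.E01 m (1 - δ) (1 + δ)) := by
  have h0 : φ 0 = 0 := hφ_id 0 (by rw [abs_zero]; exact hR.le)
  choose g V hV hval using TracePoly.exists_isLimit_potential f (hφ.of_le (by simp)) h0
  refine ⟨V, fun ε => (hV ε).isClassOf (hval ε), fun hreal δ hδ => ?_⟩
  obtain ⟨C, hC⟩ := TracePoly.exists_second_difference_bound f hφ hφ_zero h0
  -- Removing `(1 ∓ δ)/2 ‖x‖_2²` leaves `± (δ/2) ‖x‖_2² + ε F`, so `|ε| C ≤ δ` is what is needed;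
  -- `|C| + 1` avoids a sign condition on `C`.
  refine ⟨δ / (|C| + 1), by positivity, fun ε hε N hN => ?_⟩
  rw [lt_div_iff₀ (by positivity)] at hε
  have hεC : |ε| * C ≤ 2 * (δ / 2) := by
    have := mul_le_mul_of_nonneg_left ((le_abs_self C).trans (by linarith : |C| ≤ |C| + 1))
      (abs_nonneg ε)
    linarith
  set F : TracePoly.Tup m N → ℝ := fun x => (TracePoly.eval0 (TracePoly.cutoff φ x) f).re with hF
  have hval' : ∀ ε, ∀ x : TracePoly.Tup m N,
      (TracePoly.T01.val (V ε) x).re = 1 / 2 * TracePoly.sqNorm2 x + ε * F x :=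
    fun ε x => by rw [← hval ε N hN, TracePoly.potential_re]
  -- Taking `ε = 1` expresses `F` as a differentiable function minus a continuous one.
  have hFc : Continuous F := by
    have h1 : Continuous fun x : TracePoly.Tup m N => (TracePoly.T01.val (V 1) x).re :=
      Complex.continuous_re.comp (continuous_iff_continuousAt.2 fun x =>
        HasFDerivAt.continuousAt (𝕜 := ℝ) (E := TracePoly.Tup m N) (F := ℂ)
          ((hV 1).hasFDerivAt hN x))
    have h2 : F = fun x => (TracePoly.T01.val (V 1) x).re - 1 / 2 * TracePoly.sqNorm2 x := by
      funext x
      rw [hval']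
      ring
    rw [h2]
    exact h1.sub (continuous_const.mul TracePoly.continuous_sqNorm2)
  have hF2 : ∀ x k, |F (x + k) + F (x - k) - 2 * F x| ≤ C * TracePoly.sqNorm2 k := by
    intro x k
    refine le_trans ?_ (hC N hN x k)
    refine le_trans (le_of_eq ?_) (Complex.abs_re_le_norm _)
    simp [hF]
  refine ⟨fun x => ?_, ?_, ?_⟩
  · rw [← hval ε N hN, TracePoly.potential_im, hreal N hN, mul_zero]
  · refine (TracePoly.convexOn_sqNorm2_add hFc hF2 hεC).congr fun x _ => ?_
    simp only [hval']
    ring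
  -- The negative of the function is `(δ/2) ‖x‖_2² - ε F`, so the convexity lemma applies with `-ε`.
  · rw [← neg_convexOn_iff]
    refine (TracePoly.convexOn_sqNorm2_add (ε := -ε) hFc hF2 (by rwa [abs_neg])).congr fun x _ => ?_
    simp only [Pi.neg_apply, hval']
    ring
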